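/- **Conventions.** For abelian groups $G,M$, an *abelian 3-cocycle* is a pair of maps $h:G^3\to M$, $c:G^2\to M$ with $h(x,0,z)=0$ and, for all $u,x,y,z\in G$, $$h(x,y,z)+h(u,x+y,z)+h(u,x,y)=h(u,x,y+z)+h(u+x,y,z),$$ $$h(y,z,x)+c(x,y+z)+h(x,y,z)=c(x,z)+h(y,x,z)+c(x,y),$$ $$-h(z,x,y)+c(x+y,z)-h(x,y,z)=c(x,z)-h(x,z,y)+c(y,z).$$ $H^3_{ab}(G,M)$ is the group of abelian 3-cocycles modulo the coboundaries $h(x,y,z)=k(y,z)-k(x+y,z)+k(x,y+z)-k(x,y)$, $c(x,y)=k(y,x)-k(x,y)$, where $k:G^2\to M$ satisfies $k(x,0)=0=k(0,y)$. A quadratic form $q:G\to M$ is a map with $q(-x)=q(x)$ whose polarization $q(x+y)-q(x)-q(y)$ is bilinear; the Eilenberg–Mac Lane map $\mathrm{tr}:H^3_{ab}(G,M)\to\mathrm{Quad}(G,M)$ sends $[(h,c)]$ to $x\mapsto c(x,x)$. The *skeletal model* $\mathcal T(G,M,(h,c))$ is the braided monoidal category with object set $G$, $\mathrm{Aut}(X)=M$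 for every object $X$ and no other morphisms, $\otimes$ given by addition in $G$ and in $M$, associator $h$, braiding $c$, and identity unitors. A *braided categorical group* is a braided monoidal groupoid all of whose objects are $\otimes$-invertible; $\pi_0$ is its group of isomorphism classes of objects and $\pi_1$ is the automorphism group of its unit object. For a braided categorical group there is a unique class $\xi\in H^3_{ab}(\pi_0,\pi_1)$ such that an abelian 3-cocycle $(h,c)$ represents $\xi$ if and only if there is a braided monoidal equivalence from $\mathcal T(\pi_0,\pi_1,(h,c))$ to the given category inducing the identity on $\pi_0$ and on $\pi_1$; $\xi$ is called its abelian 3-cocycle. (That $\xi$ exists is part of the assertion below.) A *pointed braided fusion category* over a field $k$ is a $k$-linear abelian, rigid, braided monoidal category with $k$-bilinear tensor product, finite-dimensional Hom-spaces and simple unit object, in which every object is a finite direct sum of simple objects and every simple object is $\otimes$-invertible. (Finiteness of the number of isomorphism classes of simple objects is not needed, and not assumed.) $\mathsf C_{\mathrm{simp}}$ denotes the braided categorical group of simple objects of $\mathsf C$ and isomorphisms between them. **Theorem.** Let $\mathsf C$ be either (a) a pointed braided fusion category over an algebraically closed field $k$, or (b) a braided categorical group. Put $\mathsf G=\mathsf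 C_{\mathrm{simp}}$ in case (a) and $\mathsf G=\mathsf C$ in case (b), and let $\pi_i=\pi_i(\mathsf G)$ and $\xi\in H^3_{ab}(\pi_0,\pi_1)$ be the abelian 3-cocycle of $\mathsf G$. The following are equivalent. 1. In case (b): $\mathsf C$ is braided monoidal equivalent to a braided monoidal category which is simultaneously skeletal and strictly associative (all associators are identities). In case (a): $\mathsf C$ is $k$-linearly braided monoidal equivalent to a $k$-linear braided monoidal category which is skeletal and strictly associative on simple objects, i.e. $(X\otimes Y)\otimes Z=X\otimes(Y\otimes Z)$ and the associator $a_{X,Y,Z}$ is the identity for all simple $X,Y,Z$. 2. $\xi$ has a cocycle representative $(h,c)$ with $h=0$ and $c:\pi_0\times\pi_0\to\pi_1$ bilinear. 3. $\xi$ has a cocycle representative $(h,c)$ with $h$ trilinear and $c$ bilinear. 4. There is a bilinear map $S:\pi_0\times\pi_0\to\pi_1$ with $q(x)=S(x,x)$ for all $x\in\pi_0$, where $q=\mathrm{tr}(\xi)$ is the quadratic form attached to $\xi$. -/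

import Mathlib

open CategoryTheory MonoidalCategory

universe w v u

namespace BraidedSkeletal

/-! ### Abelian cohomology in degree three -/

section Cohomology

variable {G : Type u} {M : Type v} [AddCommGroup G] [AddCommGroup M]

/-- `f` is additive in each of its two variables. -/
def IsBilinear (f : G → G → M) : Prop :=
  (∀ x x' y, f (x + x') y = f x y + f x' y) ∧ (∀ x y y', f x (y + y') = f x y + f x y')

/-- `f` is additive in each of its three variables. -/
def IsTrilinear (f : G → G → G → M) : Prop :=
  (∀ x x' y z, f (x + x') y z = f x y z + f x' y z) ∧
  (∀ x y y' z, f x (y + y') z = f x y z + f x y' z) ∧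
  (∀ x y z z', f x y (z + z') = f x y z + f x y z')

variable (G M)

/-- The group of abelian 3-cocycles `(h, c)` of `G` with values in `M`. -/
def Z3ab : AddSubgroup ((G → G → G → M) × (G → G → M)) where
  carrier := {p |
    (∀ u x y z, p.1 x y z + p.1 u (x + y) z + p.1 u x y = p.1 u x (y + z) + p.1 (u + x) y z) ∧
    (∀ x z, p.1 x 0 z = 0) ∧
    (∀ x y z, p.1 y z x + p.2 x (y + z) + p.1 x y z = p.2 x z + p.1 y x z + p.2 x y) ∧
    (∀ x y z, -p.1 z x y + p.2 (x + y) z - p.1 x y z = p.2 x z - p.1 x z y + p.2 y z)}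
  zero_mem' := by simp
  add_mem' := by
    rintro p p' ⟨h1, h2, h3, h4⟩ ⟨k1, k2, k3, k4⟩
    refine ⟨fun u x y z => ?_, fun x z => ?_, fun x y z => ?_, fun x y z => ?_⟩
    · simp only [Prod.fst_add, Pi.add_apply]
      linear_combination (norm := abel) h1 u x y z + k1 u x y z
    · simp [h2, k2]
    · simp only [Prod.fst_add, Prod.snd_add, Pi.add_apply]
      linear_combination (norm := abel) h3 x y z + k3 x y z
    · simp only [Prod.fst_add, Prod.snd_add, Pi.add_apply]
      linear_combination (norm := abel) h4 x y z + k4 x y z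
  neg_mem' := by
    rintro p ⟨h1, h2, h3, h4⟩
    refine ⟨fun u x y z => ?_, fun x z => ?_, fun x y z => ?_, fun x y z => ?_⟩
    · simp only [Prod.fst_neg, Pi.neg_apply]
      linear_combination (norm := abel) - h1 u x y z
    · simp [h2]
    · simp only [Prod.fst_neg, Prod.snd_neg, Pi.neg_apply]
      linear_combination (norm := abel) - h3 x y z
    · simp only [Prod.fst_neg, Prod.snd_neg, Pi.neg_apply]
      linear_combination (norm := abel) - h4 x y z

variable {G M}


/-- The component `h` of an abelian 3-cocycle `(h, c)`. -/
def hmap (ω : Z3ab G M) : G → G → G → M := ω.1.1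

/-- The component `c` of an abelian 3-cocycle `(h, c)`. -/
def cmap (ω : Z3ab G M) : G → G → M := ω.1.2

variable (ω : Z3ab G M)

lemma cocycle (u x y z : G) :
    hmap ω x y z + hmap ω u (x + y) z + hmap ω u x y = hmap ω u x (y + z) + hmap ω (u + x) y z :=
  ω.2.1 u x y z

lemma h_mid_zero (x z : G) : hmap ω x 0 z = 0 := ω.2.2.1 x z

lemma hexA (x y z : G) :
    hmap ω y z x + cmap ω x (y + z) + hmap ω x y z = cmap ω x z + hmap ω y x z + cmap ω x y := ω.2.2.2.1 x y z

lemma hexA' (x y z : G) :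
    -hmap ω z x y + cmap ω (x + y) z - hmap ω x y z = cmap ω x z - hmap ω x z y + cmap ω y z := ω.2.2.2.2 x y z

lemma c_zero_zero : cmap ω 0 0 = 0 := by
  have := hexA ω 0 0 0
  simpa [h_mid_zero] using this

lemma polar (x y : G) :
    cmap ω (x + y) (x + y) - cmap ω x x - cmap ω y y = cmap ω x y + cmap ω y x := by
  have e1 := hexA ω (x + y) x y
  have e2 := hexA' ω x y y
  have e3 := hexA' ω x y x
  have e4 := cocycle ω x y x y
  rw [add_comm y x] at e4
  linear_combination (norm := abel) e1 + e2 + e3 + e4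

lemma polar_add (x y z : G) :
    cmap ω x (y + z) + cmap ω (y + z) x = (cmap ω x y + cmap ω y x) + (cmap ω x z + cmap ω z x) := by
  linear_combination (norm := abel) hexA ω x y z + hexA' ω y z x


variable (G M)

/-- The group of abelian 3-coboundaries: the pairs
`h(x,y,z) = k(y,z) - k(x+y,z) + k(x,y+z) - k(x,y)`, `c(x,y) = k(y,x) - k(x,y)`
for a map `k` with `k(x,0) = 0 = k(0,y)`. -/
def B3ab : AddSubgroup (Z3ab G M) where
  carrier := {ω | ∃ k : G → G → M, (∀ x, k x 0 = 0) ∧ (∀ y, k 0 y = 0) ∧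
    (∀ x y z, hmap ω x y z = k y z - k (x + y) z + k x (y + z) - k x y) ∧
    (∀ x y, cmap ω x y = k y x - k x y)}
  zero_mem' := ⟨fun _ _ => 0, by simp, by simp, by simp [hmap], by simp [cmap]⟩
  add_mem' := by
    rintro ω ω' ⟨k, h1, h2, h3, h4⟩ ⟨k', h1', h2', h3', h4'⟩
    refine ⟨fun x y => k x y + k' x y, by simp [h1, h1'], by simp [h2, h2'],
      fun x y z => ?_, fun x y => ?_⟩
    · change hmap ω x y z + hmap ω' x y z = _
      simp only [h3, h3']; abel
    · change cmap ω x y + cmap ω' x y = _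
      simp only [h4, h4']; abel
  neg_mem' := by
    rintro ω ⟨k, h1, h2, h3, h4⟩
    refine ⟨fun x y => - k x y, by simp [h1], by simp [h2], fun x y z => ?_, fun x y => ?_⟩
    · change - hmap ω x y z = _
      simp only [h3]; abel
    · change - cmap ω x y = _
      simp only [h4]; abel

/-- Every pair built from a normalized map `k` as in `B3ab` is an abelian 3-cocycle. -/
lemma coboundary_mem_Z3ab (k : G → G → M) (hk : ∀ x, k x 0 = 0) (hk' : ∀ y, k 0 y = 0) :
    ((fun x y z => k y z - k (x + y) z + k x (y + z) - k x y, fun x y => k y x - k x y) :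
      (G → G → G → M) × (G → G → M)) ∈ Z3ab G M := by
  refine ⟨fun u x y z => ?_, fun x z => ?_, fun x y z => ?_, fun x y z => ?_⟩
  · simp only [add_assoc]; abel
  · simp [hk, hk']
  · simp only [add_comm z x, add_comm y x]; abel
  · simp only [add_comm z x, add_comm z y]; abel

/-- Third abelian cohomology `H³_ab(G, M)`. -/
abbrev H3ab : Type (max u v) := Z3ab G M ⧸ B3ab G M

/-- The group `Quad(G, M)` of quadratic forms: maps `q` with `q(-x) = q(x)` whose
polarization `q(x + y) - q(x) - q(y)` is bilinear. -/
def Quad : AddSubgroup (G → M) where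
  carrier := {q | (∀ x, q (-x) = q x) ∧ IsBilinear fun x y => q (x + y) - q x - q y}
  zero_mem' := by simp [IsBilinear]
  add_mem' := by
    rintro q q' ⟨h1, h2, h3⟩ ⟨h1', h2', h3'⟩
    dsimp only at h2 h3 h2' h3'
    refine ⟨by simp [h1, h1'], fun x x' y => ?_, fun x y y' => ?_⟩
    · simp only [Pi.add_apply]
      linear_combination (norm := abel) h2 x x' y + h2' x x' y
    · simp only [Pi.add_apply]
      linear_combination (norm := abel) h3 x y y' + h3' x y y'
  neg_mem' := by
    rintro q ⟨h1, h2, h3⟩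
    dsimp only at h2 h3
    refine ⟨by simp [h1], fun x x' y => ?_, fun x y y' => ?_⟩
    · simp only [Pi.neg_apply]
      linear_combination (norm := abel) - h2 x x' y
    · simp only [Pi.neg_apply]
      linear_combination (norm := abel) - h3 x y y'

variable {G M}

/-- The diagonal `x ↦ c(x,x)` of an abelian 3-cocycle is a quadratic form. -/
lemma diag_mem_Quad (ω : Z3ab G M) : (fun x => cmap ω x x) ∈ Quad G M := by
  have hb : ∀ x y z, cmap ω x (y + z) + cmap ω (y + z) x
      = (cmap ω x y + cmap ω y x) + (cmap ω x z + cmap ω z x) := polar_add ω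
  refine ⟨fun x => ?_, fun x x' y => ?_, fun x y y' => ?_⟩
  · have h0 := c_zero_zero ω
    have e1 := polar ω x (-x)
    have e2 := hb x x (-x)
    have e3 := hb x 0 0
    simp only [add_neg_cancel, add_zero] at e1 e2 e3
    have e4 : cmap ω x 0 + cmap ω 0 x = 0 := by
      simpa using e3
    rw [e4] at e2
    rw [h0] at e1
    linear_combination (norm := abel) - e1 + e2
  · simp only [polar]
    linear_combination (norm := abel) hb y x x'
  · simp only [polar]
    linear_combination (norm := abel) hb x y y'

/-- The Eilenberg–Mac Lane trace map `H³_ab(G, M) → Quad(G, M)`, `[(h, c)] ↦ (x ↦ c(x,x))`. -/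
def trace : H3ab G M →+ Quad G M :=
  QuotientAddGroup.lift (B3ab G M)
    { toFun := fun ω => ⟨fun x => cmap ω x x, diag_mem_Quad ω⟩
      map_zero' := rfl
      map_add' := fun _ _ => rfl } (by
    rintro ω ⟨k, -, -, -, hc⟩
    apply Subtype.ext
    funext x
    change cmap ω x x = 0
    rw [hc, sub_self])

end Cohomology

/-! ### Skeletal models -/

section Model

variable {G : Type u} {M : Type v} [AddCommGroup G] [AddCommGroup M]

/-- Objects of the skeletal model `𝒯(G, M, (h, c))`: the elements of `G`. -/
@[ext]
structure SkeletalModel (ω : Z3ab G M) : Type u where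
  /-- the underlying element of `G` -/
  of : G

namespace SkeletalModel

variable {ω : Z3ab G M}

/-- A morphism `X ⟶ Y` exists only if `X = Y`, and is then an element of `M`. -/
@[ext]
structure Hom (X Y : SkeletalModel ω) : Type v where
  eq : X = Y
  /-- the underlying element of `M` -/
  val : M

instance : Category.{v} (SkeletalModel ω) where
  Hom := Hom
  id _ := ⟨rfl, 0⟩
  comp f g := ⟨f.eq.trans g.eq, f.val + g.val⟩
  id_comp _ := Hom.ext (zero_add _)
  comp_id _ := Hom.ext (add_zero _)
  assoc _ _ _ := Hom.ext (add_assoc _ _ _)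

lemma hom_ext' {X Y : SkeletalModel ω} {f g : X ⟶ Y} (h : Hom.val f = Hom.val g) : f = g :=
  Hom.ext h

@[simp] lemma val_id (X : SkeletalModel ω) : Hom.val (𝟙 X) = 0 := rfl

@[simp] lemma val_comp {X Y Z : SkeletalModel ω} (f : X ⟶ Y) (g : Y ⟶ Z) :
    Hom.val (f ≫ g) = Hom.val f + Hom.val g := rfl

/-- An equality of objects and an element of `M` give an isomorphism. -/
def isoMk {X Y : SkeletalModel ω} (e : X = Y) (m : M) : X ≅ Y where
  hom := Hom.mk e m
  inv := Hom.mk e.symm (-m)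
  hom_inv_id := hom_ext' (add_neg_cancel m)
  inv_hom_id := hom_ext' (neg_add_cancel m)

@[simp] lemma val_isoMk_hom {X Y : SkeletalModel ω} (e : X = Y) (m : M) :
    Hom.val (isoMk e m).hom = m := rfl

@[simp] lemma val_isoMk_inv {X Y : SkeletalModel ω} (e : X = Y) (m : M) :
    Hom.val (isoMk e m).inv = -m := rfl

/-- The tensor product is the addition of `G` on objects and of `M` on morphisms; the
associator is `h`, and the unit isomorphisms are identities. -/
instance : MonoidalCategoryStruct (SkeletalModel ω) where
  tensorObj X Y := ⟨X.of + Y.of⟩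
  whiskerLeft _ _ _ f := Hom.mk (by rw [Hom.eq f]) (Hom.val f)
  whiskerRight f _ := Hom.mk (by rw [Hom.eq f]) (Hom.val f)
  tensorHom f g := Hom.mk (by rw [Hom.eq f, Hom.eq g]) (Hom.val f + Hom.val g)
  tensorUnit := ⟨0⟩
  associator X Y Z := isoMk (SkeletalModel.ext (add_assoc _ _ _)) (hmap ω X.of Y.of Z.of)
  leftUnitor _ := isoMk (SkeletalModel.ext (zero_add _)) 0
  rightUnitor _ := isoMk (SkeletalModel.ext (add_zero _)) 0

@[simp] lemma of_tensor (X Y : SkeletalModel ω) : (X ⊗ Y).of = X.of + Y.of := rfl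

@[simp] lemma of_unit : (𝟙_ (SkeletalModel ω)).of = 0 := rfl

@[simp] lemma val_whiskerLeft (X : SkeletalModel ω) {Y Z : SkeletalModel ω} (f : Y ⟶ Z) :
    Hom.val (X ◁ f) = Hom.val f := rfl

@[simp] lemma val_whiskerRight {Y Z : SkeletalModel ω} (f : Y ⟶ Z) (X : SkeletalModel ω) :
    Hom.val (f ▷ X) = Hom.val f := rfl

@[simp] lemma val_tensorHom {X Y Z W : SkeletalModel ω} (f : X ⟶ Y) (g : Z ⟶ W) :
    Hom.val (f ⊗ₘ g) = Hom.val f + Hom.val g := rfl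

@[simp] lemma val_associator_hom (X Y Z : SkeletalModel ω) :
    Hom.val (α_ X Y Z).hom = hmap ω X.of Y.of Z.of := rfl

@[simp] lemma val_associator_inv (X Y Z : SkeletalModel ω) :
    Hom.val (α_ X Y Z).inv = -hmap ω X.of Y.of Z.of := rfl

@[simp] lemma val_leftUnitor_hom (X : SkeletalModel ω) : Hom.val (λ_ X).hom = 0 := rfl

@[simp] lemma val_rightUnitor_hom (X : SkeletalModel ω) : Hom.val (ρ_ X).hom = 0 := rfl

instance : MonoidalCategory (SkeletalModel ω) where
  tensorHom_def _ _ := hom_ext' (by simp)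
  id_tensorHom_id _ _ := hom_ext' (by simp)
  tensorHom_comp_tensorHom _ _ _ _ := hom_ext' (by simp; abel)
  whiskerLeft_id _ _ := hom_ext' (by simp)
  id_whiskerRight _ _ := hom_ext' (by simp)
  associator_naturality {X₁ X₂ X₃ Y₁ Y₂ Y₃} f g k := hom_ext' (by
    obtain rfl : X₁ = Y₁ := Hom.eq f
    obtain rfl : X₂ = Y₂ := Hom.eq g
    obtain rfl : X₃ = Y₃ := Hom.eq k
    simp; abel)
  leftUnitor_naturality _ := hom_ext' (by simp)
  rightUnitor_naturality _ := hom_ext' (by simp)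
  pentagon W X Y Z := hom_ext' (by
    have := cocycle ω W.of X.of Y.of Z.of
    simp only [val_comp, val_whiskerLeft, val_whiskerRight, val_associator_hom, of_tensor]
    linear_combination (norm := abel) this)
  triangle X Y := hom_ext' (by simp [h_mid_zero])

/-- The braiding is `c`. -/
instance : BraidedCategory (SkeletalModel ω) where
  braiding X Y := isoMk (SkeletalModel.ext (add_comm _ _)) (cmap ω X.of Y.of)
  braiding_naturality_right X {Y Z} f := hom_ext' (by
    obtain rfl : Y = Z := Hom.eq f
    simp [add_comm])
  braiding_naturality_left {X Y} f Z := hom_ext' (by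
    obtain rfl : X = Y := Hom.eq f
    simp [add_comm])
  hexagon_forward X Y Z := hom_ext' (by
    have := hexA ω X.of Y.of Z.of
    simp only [val_comp, val_whiskerLeft, val_whiskerRight, val_associator_hom, of_tensor,
      val_isoMk_hom]
    linear_combination (norm := abel) this)
  hexagon_reverse X Y Z := hom_ext' (by
    have := hexA' ω X.of Y.of Z.of
    simp only [val_comp, val_whiskerLeft, val_whiskerRight, val_associator_inv, of_tensor,
      val_isoMk_hom]
    linear_combination (norm := abel) this)

/-- The element `m` of `M` as an automorphism of the tensor unit. -/
def unitHom (ω : Z3ab G M) (m : M) : 𝟙_ (SkeletalModel ω) ⟶ 𝟙_ (SkeletalModel ω) :=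
  Hom.mk rfl m

end SkeletalModel

end Model

/-! ### Braided categorical groups -/

lemma unit_endo_comm {C : Type u} [Category.{v} C] [MonoidalCategory C]
    (f g : 𝟙_ C ⟶ 𝟙_ C) : f ≫ g = g ≫ f := by
  have h1 : f = (λ_ (𝟙_ C)).inv ≫ f ▷ 𝟙_ C ≫ (λ_ (𝟙_ C)).hom := by
    rw [unitors_equal, rightUnitor_naturality, ← unitors_equal, Iso.inv_hom_id_assoc]
  have h2 : g = (λ_ (𝟙_ C)).inv ≫ 𝟙_ C ◁ g ≫ (λ_ (𝟙_ C)).hom := by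
    rw [leftUnitor_naturality, Iso.inv_hom_id_assoc]
  rw [h1, h2]
  simp only [Category.assoc, Iso.hom_inv_id_assoc]
  rw [← whisker_exchange_assoc]

section BCG

variable (C : Type u) [Category.{v} C] [MonoidalCategory C] [BraidedCategory C]

/-- A braided categorical group: a braided monoidal groupoid whose objects are all
invertible with respect to the tensor product. -/
class IsBraidedCategoricalGroup : Prop where
  isIso : ∀ {X Y : C} (f : X ⟶ Y), IsIso f
  exists_inverse : ∀ X : C, ∃ Y : C, Nonempty (Y ⊗ X ≅ 𝟙_ C)

/-- `π₀`: isomorphism classes of objects, with addition induced by the tensor product. -/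
def Pi0 : Type u := Additive (Skeleton C)

/-- `π₁`: the automorphisms of the tensor unit, written additively. -/
def Pi1 : Type v := Additive (Aut (𝟙_ C))

variable {C}

/-- The class of an object in `π₀`. -/
def Pi0.mk (X : C) : Pi0 C := Additive.ofMul (toSkeleton X)

/-- The automorphism of the tensor unit underlying an element of `π₁`. -/
def Pi1.toAut (m : Pi1 C) : Aut (𝟙_ C) := Additive.toMul m

noncomputable instance : AddCommMonoid (Pi0 C) :=
  inferInstanceAs (AddCommMonoid (Additive (Skeleton C)))

lemma Pi0.mk_tensor (X Y : C) : Pi0.mk (X ⊗ Y) = Pi0.mk X + Pi0.mk Y :=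
  congrArg Additive.ofMul (Skeleton.toSkeleton_tensorObj X Y)

lemma Pi0.mk_unit : Pi0.mk (𝟙_ C) = 0 := rfl

lemma Pi0.exists_neg [IsBraidedCategoricalGroup C] (x : Pi0 C) : ∃ y : Pi0 C, y + x = 0 := by
  obtain ⟨X, rfl⟩ : ∃ X : C, Pi0.mk X = x :=
    ⟨Quotient.out (s := isIsomorphicSetoid C) x, Quotient.out_eq (s := isIsomorphicSetoid C) x⟩
  obtain ⟨Y, hY⟩ := IsBraidedCategoricalGroup.exists_inverse X
  exact ⟨Pi0.mk Y, by
    rw [← Pi0.mk_tensor, ← Pi0.mk_unit]; exact toSkeleton_eq_toSkeleton_iff.2 hY⟩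

noncomputable instance [IsBraidedCategoricalGroup C] : AddCommGroup (Pi0 C) :=
  letI : Neg (Pi0 C) := ⟨fun x => (Pi0.exists_neg x).choose⟩
  { (inferInstance : AddCommMonoid (Pi0 C)) with
    neg_add_cancel := fun x => (Pi0.exists_neg x).choose_spec
    zsmul := zsmulRec }

instance : AddCommGroup (Pi1 C) :=
  { (inferInstanceAs (AddGroup (Additive (Aut (𝟙_ C)))) : AddGroup (Pi1 C)) with
    add_comm := fun _ _ => Iso.ext (unit_endo_comm _ _) }

variable (C)

/-- `(h, c)` is an abelian 3-cocycle of `C`: there is a braided monoidal equivalence from the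
skeletal model `𝒯(π₀, π₁, (h, c))` to `C` that induces the identity on `π₀` and on `π₁`. -/
def IsAbelianCocycleOf [IsBraidedCategoricalGroup C] (ω : Z3ab (Pi0 C) (Pi1 C)) : Prop :=
  ∃ (F : SkeletalModel ω ⥤ C) (_ : F.Braided), F.IsEquivalence ∧
    (∀ X : SkeletalModel ω, Pi0.mk (F.obj X) = X.of) ∧
    (∀ m : Pi1 C, Functor.LaxMonoidal.ε F ≫ F.map (SkeletalModel.unitHom ω m) =
      m.toAut.hom ≫ Functor.LaxMonoidal.ε F)

/-- `C` is braided monoidal equivalent to a simultaneously skeletal and strictly associative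
braided monoidal category. -/
def EquivSkeletalStrict : Prop :=
  ∃ (D : Type u) (_ : Category.{v} D) (_ : MonoidalCategory D) (_ : BraidedCategory D)
    (F : C ⥤ D) (_ : F.Braided), F.IsEquivalence ∧ Skeletal D ∧
    ∀ X Y Z : D, ∃ e : (X ⊗ Y) ⊗ Z = X ⊗ (Y ⊗ Z), (α_ X Y Z).hom = eqToHom e

end BCG

/-! ### Pointed braided fusion categories -/

section Core

variable (C : Type u) [Category.{v} C] [MonoidalCategory C]

/-- The core of a monoidal category inherits the monoidal structure. -/
instance coreMonoidalStruct : MonoidalCategoryStruct (Core C) where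
  tensorObj X Y := ⟨X.of ⊗ Y.of⟩
  whiskerLeft X _ _ f := ⟨whiskerLeftIso X.of f.iso⟩
  whiskerRight f Y := ⟨whiskerRightIso f.iso Y.of⟩
  tensorHom f g := ⟨f.iso ⊗ᵢ g.iso⟩
  tensorUnit := ⟨𝟙_ C⟩
  associator X Y Z := Core.isoMk (α_ X.of Y.of Z.of)
  leftUnitor X := Core.isoMk (λ_ X.of)
  rightUnitor X := Core.isoMk (ρ_ X.of)

instance coreMonoidal : MonoidalCategory (Core C) where
  tensorHom_def f g := Core.hom_ext (tensorHom_def f.iso.hom g.iso.hom)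
  id_tensorHom_id X Y := Core.hom_ext (id_tensorHom_id X.of Y.of)
  tensorHom_comp_tensorHom f₁ f₂ g₁ g₂ :=
    Core.hom_ext (tensorHom_comp_tensorHom f₁.iso.hom f₂.iso.hom g₁.iso.hom g₂.iso.hom)
  whiskerLeft_id X Y := Core.hom_ext (whiskerLeft_id X.of Y.of)
  id_whiskerRight X Y := Core.hom_ext (id_whiskerRight X.of Y.of)
  associator_naturality f g h :=
    Core.hom_ext (associator_naturality f.iso.hom g.iso.hom h.iso.hom)
  leftUnitor_naturality f := Core.hom_ext (leftUnitor_naturality f.iso.hom)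
  rightUnitor_naturality f := Core.hom_ext (rightUnitor_naturality f.iso.hom)
  pentagon W X Y Z := Core.hom_ext (pentagon W.of X.of Y.of Z.of)
  triangle X Y := Core.hom_ext (triangle X.of Y.of)

instance coreBraided [BraidedCategory C] : BraidedCategory (Core C) where
  braiding X Y := Core.isoMk (β_ X.of Y.of)
  braiding_naturality_right X {_ _} f :=
    Core.hom_ext (BraidedCategory.braiding_naturality_right X.of f.iso.hom)
  braiding_naturality_left f Z :=
    Core.hom_ext (BraidedCategory.braiding_naturality_left f.iso.hom Z.of)
  hexagon_forward X Y Z := Core.hom_ext (BraidedCategory.hexagon_forward X.of Y.of Z.of)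
  hexagon_reverse X Y Z := Core.hom_ext (BraidedCategory.hexagon_reverse X.of Y.of Z.of)

end Core

section Fusion

attribute [local instance] Abelian.hasFiniteBiproducts

/-- The finiteness and semisimplicity conditions on a `k`-linear abelian category: all
`Hom`-spaces are finite-dimensional and every object is a finite direct sum of simple objects. -/
class IsFinSemisimple (k : Type w) [Field k] (C : Type u) [Category.{v} C] [Abelian C]
    [Linear k C] : Prop where
  finite_hom : ∀ X Y : C, FiniteDimensional k (X ⟶ Y)
  semisimple : ∀ X : C, ∃ (n : ℕ) (S : Fin n → C), (∀ i, Simple (S i)) ∧ Nonempty (X ≅ ⨁ S)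

/-- A monoidal category is pointed if all its simple objects are invertible. -/
class IsPointed (C : Type u) [Category.{v} C] [Limits.HasZeroMorphisms C]
    [MonoidalCategory C] : Prop where
  invertible : ∀ X : C, Simple X → ∃ Y : C, Nonempty (X ⊗ Y ≅ 𝟙_ C) ∧ Nonempty (Y ⊗ X ≅ 𝟙_ C)

variable (C : Type u) [Category.{v} C] [Limits.HasZeroMorphisms C] [MonoidalCategory C]

/-- The property of being a simple object. -/
def IsSimple : ObjectProperty C := fun X => Simple X

variable {C}

/-- Tensoring with an invertible object is an equivalence of categories. -/
def tensorLeftEquiv {X Y : C} (e : X ⊗ Y ≅ 𝟙_ C) (e' : Y ⊗ X ≅ 𝟙_ C) : C ≌ C :=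
  CategoryTheory.Equivalence.mk (tensorLeft X) (tensorLeft Y)
    (NatIso.ofComponents
      (fun Z => (λ_ Z).symm ≪≫ whiskerRightIso e'.symm Z ≪≫ α_ Y X Z)
      (by
        intro Z W f
        have h := whisker_exchange e'.inv f
        simp only [id_whiskerLeft, tensor_whiskerLeft] at h
        simp [← cancel_mono (α_ Y X W).inv, ← h]))
    (NatIso.ofComponents
      (fun Z => (α_ X Y Z).symm ≪≫ whiskerRightIso e Z ≪≫ λ_ Z)
      (by
        intro Z W f
        have h := whisker_exchange e.hom f
        simp only [id_whiskerLeft, tensor_whiskerLeft] at h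
        simp only [Category.assoc] at h
        simp [← cancel_epi (α_ X Y Z).hom, reassoc_of% h]))

lemma simple_tensor [IsPointed C] {X Y : C} (hX : Simple X) (hY : Simple Y) :
    Simple (X ⊗ Y) := by
  obtain ⟨Z, ⟨e⟩, ⟨e'⟩⟩ := IsPointed.invertible X hX
  have := simple_obj (tensorLeftEquiv e e').functor Y
  exact this

instance [Simple (𝟙_ C)] [IsPointed C] : (IsSimple C).IsMonoidal where
  prop_unit := ‹Simple (𝟙_ C)›
  prop_tensor _ _ h₁ h₂ := simple_tensor h₁ h₂

variable (C)

/-- The groupoid of simple objects: the full subcategory of simple objects, keeping only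
the isomorphisms as morphisms. -/
abbrev CSimp : Type u := Core (IsSimple C).FullSubcategory

lemma simple_of_inverse [Simple (𝟙_ C)] {X Y : C} (e : X ⊗ Y ≅ 𝟙_ C) (e' : Y ⊗ X ≅ 𝟙_ C) :
    Simple Y := by
  have : Simple ((tensorLeftEquiv e e').functor.obj Y) := Simple.of_iso e
  exact (simple_obj_iff (tensorLeftEquiv e e').functor Y).1 this

instance [Simple (𝟙_ C)] [IsPointed C] [BraidedCategory C] :
    IsBraidedCategoricalGroup (CSimp C) where
  isIso f := inferInstance
  exists_inverse X := by
    obtain ⟨Y, ⟨e⟩, ⟨e'⟩⟩ := IsPointed.invertible X.of.obj X.of.property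
    exact ⟨⟨⟨Y, simple_of_inverse C e e'⟩⟩, ⟨Core.isoMk ((IsSimple C).isoMk e')⟩⟩

end Fusion

section FusionStrict

/-- `C` is `k`-linearly braided monoidal equivalent to a skeletal `k`-linear braided monoidal
category that is strictly associative on simple objects. -/
def LinearEquivSkeletalStrict (k : Type w) [Field k] (C : Type u) [Category.{v} C]
    [Preadditive C] [Linear k C] [MonoidalCategory C] [BraidedCategory C] : Prop :=
  ∃ (D : Type u) (_ : Category.{v} D) (_ : Preadditive D) (_ : Linear k D)
    (_ : MonoidalCategory D) (_ : BraidedCategory D)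
    (F : C ⥤ D) (_ : F.Braided), F.IsEquivalence ∧ F.Additive ∧ F.Linear k ∧ Skeletal D ∧
    ∀ X Y Z : D, Simple X → Simple Y → Simple Z →
      ∃ e : (X ⊗ Y) ⊗ Z = X ⊗ (Y ⊗ Z), (α_ X Y Z).hom = eqToHom e

end FusionStrict

end BraidedSkeletal

open BraidedSkeletal

namespace BraidedSkeletal

/-! ### Normalized maps and trivializations of abelian 3-cocycles -/

section Splitting

variable {G : Type u} {M : Type v} [AddCommGroup G] [AddCommGroup M]

/-! The heart is the injectivity of the Eilenberg–Mac Lane trace (`trace_injective`). If q(x) =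
S(x,x) with S bilinear, then (0, S) is an abelian 3-cocycle with the same trace as ξ, so it
represents ξ. This gives 4 → 2. The steps 2 → 3 → 4 are immediate, and once h = 0 the hexagons say
exactly that c is bilinear.

For injectivity, let c(x,x) = 0 for all x. On ℤ such a cocycle is trivialized by summation
(`exists_trivializes_int`). A trivialization is extended over one further generator by splitting a
direct sum (`exists_trivializes_product`): the interchange constraint of the skeletal model removes
h, and what remains of c is alternating and bilinear. Zorn's lemma then covers all free abelian
groups. For general G and injective M, the cocycle is pulled back to the free group ℤ[G]. The
obstruction to descending the trivialization is a symmetric 2-cocycle on the relations, that is, an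
abelian extension by M, and it splits (`Trivializes.descend`). Finally, an arbitrary M is embedded
in a divisible D. A D-valued trivialization is, modulo M, a symmetric 2-cocycle with values in the
divisible group D/M; splitting that extension moves the trivialization into M
(`exists_trivializes`).

On the categorical side, representatives of π₀ with chosen tensor isomorphisms give a skeletal
category in which a morphism is an element of π₁ (`Valuation`); the coherence axioms become the
cocycle equations. If the category is equivalent to a skeletal strict one, the isomorphisms can be
chosen to become equalities there, and h = 0. Conversely the model of (0, c) is skeletal and strict.
In the fusion case the simple objects are named by this model, and the other isomorphism classes are
represented arbitrarily. -/

lemma h_left_zero (ω : Z3ab G M) (y z : G) : hmap ω 0 y z = 0 := by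
  have := cocycle ω 0 0 y z
  simpa [h_mid_zero] using this

lemma h_right_zero (ω : Z3ab G M) (x y : G) : hmap ω x y 0 = 0 := by
  have := cocycle ω x y 0 0
  simpa [h_mid_zero] using this

lemma c_right_zero (ω : Z3ab G M) (x : G) : cmap ω x 0 = 0 := by
  have := hexA ω x 0 0
  simpa [h_mid_zero, h_left_zero, h_right_zero] using this

lemma c_left_zero (ω : Z3ab G M) (x : G) : cmap ω 0 x = 0 := by
  have := hexA' ω 0 0 x
  simpa [h_mid_zero, h_left_zero, h_right_zero] using this

/-- A map on pairs vanishing as soon as one of the arguments does. -/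
def IsNormalized (k : G → G → M) : Prop := (∀ x, k x 0 = 0) ∧ ∀ y, k 0 y = 0

/-- The coboundary of a normalized map. -/
def coboundary (k : G → G → M) (hk : IsNormalized k) : Z3ab G M :=
  ⟨_, coboundary_mem_Z3ab G M k hk.1 hk.2⟩

@[simp] lemma hmap_sub_coboundary (ω : Z3ab G M) (k : G → G → M) (hk : IsNormalized k)
    (x y z : G) : hmap (ω - coboundary k hk) x y z =
      hmap ω x y z - (k y z - k (x + y) z + k x (y + z) - k x y) := rfl

@[simp] lemma cmap_sub_coboundary (ω : Z3ab G M) (k : G → G → M) (hk : IsNormalized k)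
    (x y : G) : cmap (ω - coboundary k hk) x y = cmap ω x y - (k y x - k x y) := rfl

/-- The normalized map `k` trivializes the abelian 3-cocycle `ω` on the subgroup `S`. -/
structure Trivializes (ω : Z3ab G M) (S : AddSubgroup G) (k : G → G → M) : Prop where
  normalized : IsNormalized k
  h_eq : ∀ x ∈ S, ∀ y ∈ S, ∀ z ∈ S, hmap ω x y z = k y z - k (x + y) z + k x (y + z) - k x y
  c_eq : ∀ x ∈ S, ∀ y ∈ S, cmap ω x y = k y x - k x y

/-- Allows a trivialization to be built in stages: subtract the coboundary of any normalized map,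
trivialize the rest, and add the two maps. -/
lemma Trivializes.add {ω : Z3ab G M} {S : AddSubgroup G} {k k' : G → G → M}
    (hk : IsNormalized k) (hk' : Trivializes (ω - coboundary k hk) S k') :
    Trivializes ω S (fun x y => k x y + k' x y) where
  normalized := ⟨fun x => by simp [hk.1, hk'.normalized.1],
    fun x => by simp [hk.2, hk'.normalized.2]⟩
  h_eq x hx y hy z hz := by
    have := hk'.h_eq x hx y hy z hz
    rw [hmap_sub_coboundary, sub_eq_iff_eq_add] at this
    rw [this]; abel
  c_eq x hx y hy := by
    have := hk'.c_eq x hx y hy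
    rw [cmap_sub_coboundary, sub_eq_iff_eq_add] at this
    rw [this]; abel

lemma mem_B3ab_iff (ω : Z3ab G M) : ω ∈ B3ab G M ↔ ∃ k, Trivializes ω ⊤ k :=
  ⟨fun ⟨k, h1, h2, h3, h4⟩ => ⟨k, ⟨h1, h2⟩, fun x _ y _ z _ => h3 x y z, fun x _ y _ => h4 x y⟩,
    fun ⟨k, h⟩ => ⟨k, h.normalized.1, h.normalized.2,
      fun x y z => h.h_eq x trivial y trivial z trivial, fun x y => h.c_eq x trivial y trivial⟩⟩

/-- Pullback of abelian 3-cocycles. -/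
def pullback {G' : Type*} [AddCommGroup G'] (φ : G' →+ G) (ω : Z3ab G M) : Z3ab G' M :=
  ⟨(fun x y z => hmap ω (φ x) (φ y) (φ z), fun x y => cmap ω (φ x) (φ y)),
    fun u x y z => by simpa using cocycle ω (φ u) (φ x) (φ y) (φ z),
    fun x z => by simpa using h_mid_zero ω (φ x) (φ z),
    fun x y z => by simpa using hexA ω (φ x) (φ y) (φ z),
    fun x y z => by simpa using hexA' ω (φ x) (φ y) (φ z)⟩

@[simp] lemma hmap_pullback {G' : Type*} [AddCommGroup G'] (φ : G' →+ G) (ω : Z3ab G M)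
    (x y z : G') : hmap (pullback φ ω) x y z = hmap ω (φ x) (φ y) (φ z) := rfl

@[simp] lemma cmap_pullback {G' : Type*} [AddCommGroup G'] (φ : G' →+ G) (ω : Z3ab G M)
    (x y : G') : cmap (pullback φ ω) x y = cmap ω (φ x) (φ y) := rfl

/-- Pushforward of abelian 3-cocycles. -/
def pushforward {M' : Type*} [AddCommGroup M'] (ψ : M →+ M') (ω : Z3ab G M) : Z3ab G M' :=
  ⟨(fun x y z => ψ (hmap ω x y z), fun x y => ψ (cmap ω x y)),
    fun u x y z => by simpa using congrArg ψ (cocycle ω u x y z),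
    fun x z => by simpa using congrArg ψ (h_mid_zero ω x z),
    fun x y z => by simpa using congrArg ψ (hexA ω x y z),
    fun x y z => by simpa using congrArg ψ (hexA' ω x y z)⟩

/-! ### Infinite cyclic groups -/

lemma exists_antiderivative (f : ℤ → M) : ∃ g : ℤ → M, g 0 = 0 ∧ ∀ n, g (n + 1) = g n + f n := by
  refine ⟨fun n => Int.inductionOn' n 0 (motive := fun _ => M) 0 (fun k _ a => a + f k)
    (fun k _ a => a - f (k - 1)), ?_, fun n => ?_⟩
  · exact Int.inductionOn'_self
  · rcases le_or_gt 0 n with hn | hn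
    · exact Int.inductionOn'_add_one hn
    · have := Int.inductionOn'_sub_one (motive := fun _ => M) (b := 0) (zero := (0 : M))
        (succ := fun k _ a => a + f k) (pred := fun k _ a => a - f (k - 1)) (z := n + 1) (by omega)
      simp only [add_sub_cancel_right] at this
      dsimp only
      rw [this]; abel

/-- Without the associator terms the two hexagons are additivity of c in each variable. For S = ⊤
this also shows that a strict representative has bilinear c. -/
lemma isBilinear_of_h_eq_zero (ω : Z3ab G M) (S : AddSubgroup G)
    (h : ∀ x ∈ S, ∀ y ∈ S, ∀ z ∈ S, hmap ω x y z = 0) {x y z : G} (hx : x ∈ S) (hy : y ∈ S)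
    (hz : z ∈ S) : cmap ω (x + y) z = cmap ω x z + cmap ω y z ∧
      cmap ω x (y + z) = cmap ω x y + cmap ω x z := by
  have e1 := hexA ω x y z
  have e2 := hexA' ω x y z
  rw [h y hy z hz x hx, h x hx y hy z hz, h y hy x hx z hz] at e1
  rw [h z hz x hx y hy, h x hx y hy z hz, h x hx z hz y hy] at e2
  refine ⟨by simpa using e2, by simpa [add_comm] using e1⟩

/-- Summing h(x,y,1) over y gives a k whose coboundary removes h(x,y,1). The pentagon then makes
h(x,y,z) independent of z, so h = 0; now c is bilinear and determined by c(1,1) = 0. -/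
lemma exists_trivializes_int (ω : Z3ab ℤ M) (hω : cmap ω 1 1 = 0) :
    ∃ k, Trivializes ω ⊤ k := by
  choose k hk0 hk1 using fun x => exists_antiderivative fun y => hmap ω x y 1
  have hk : IsNormalized k := by
    refine ⟨hk0, fun y => ?_⟩
    induction y using Int.induction_on with
    | zero => exact hk0 0
    | succ n ih => rw [hk1, ih, h_left_zero, add_zero]
    | pred n ih =>
      have := hk1 0 (-n - 1)
      rw [h_left_zero, add_zero] at this
      rw [← this, ← ih]; congr 1; ring
  set ω' := ω - coboundary k hk with hω'
  have h1 : ∀ x y, hmap ω' x y 1 = 0 := fun x y => by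
    have hk10 : ∀ x, k x 1 = 0 := fun x => by
      have := hk1 x 0
      rwa [zero_add, hk0, h_mid_zero, add_zero] at this
    simp [hω', hk1, hk10]
  have h2 : ∀ x y z, hmap ω' x y (z + 1) = hmap ω' x y z := fun x y z => by
    have := cocycle ω' x y z 1
    simpa [h1] using this.symm
  have h3 : ∀ x y z, hmap ω' x y z = 0 := fun x y z => by
    induction z using Int.induction_on with
    | zero => exact h_right_zero ω' x y
    | succ n ih => rw [h2, ih]
    | pred n ih =>
      rw [← ih, ← h2]; congr 1; ring
  have hb := fun x y z => isBilinear_of_h_eq_zero ω' ⊤ (fun x _ y _ z _ => h3 x y z)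
    (x := x) (y := y) (z := z) trivial trivial trivial
  have c1 : cmap ω' 1 1 = 0 := by simp [hω', hω]
  have c2 : ∀ y, cmap ω' 1 y = 0 := fun y => by
    have := map_zsmul (AddMonoidHom.mk' (cmap ω' 1) fun y z => (hb 1 y z).2) y 1
    simpa [c1] using this
  have c3 : ∀ x y, cmap ω' x y = 0 := fun x y => by
    have := map_zsmul (AddMonoidHom.mk' (cmap ω' · y) fun x z => (hb x z y).1) x 1
    simpa [c2] using this
  refine ⟨_, Trivializes.add (k' := fun _ _ => 0) hk ⟨⟨by simp, by simp⟩, ?_, ?_⟩⟩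
  · intro x _ y _ z _
    rw [h3]; simp
  · intro x _ y _
    rw [c3]; simp

/-! ### Products -/

/-- G is the direct sum of the images of p and q, and ω already vanishes on both parts of S. The
interchange (a+b)+(a'+b') → (a+a')+(b+b') in the skeletal model compares h with its restrictions to
the summands. The final clause ensures that nothing changes on the p-summand, which is what
extending a given trivialization requires. -/
lemma exists_trivializes_product (ω : Z3ab G M) (p q : G →+ G) (hpq : ∀ x, p x + q x = x)
    (S : AddSubgroup G) (hp : ∀ x ∈ S, p x ∈ S) (hq : ∀ x ∈ S, q x ∈ S)
    (hpp : ∀ x, q (p x) = 0)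
    (hω : ∀ x ∈ S, cmap ω x x = 0)
    (h1 : ∀ x ∈ S, ∀ y ∈ S, ∀ z ∈ S, hmap ω (p x) (p y) (p z) = 0)
    (h2 : ∀ x ∈ S, ∀ y ∈ S, ∀ z ∈ S, hmap ω (q x) (q y) (q z) = 0)
    (c1 : ∀ x ∈ S, ∀ y ∈ S, cmap ω (p x) (p y) = 0)
    (c2 : ∀ x ∈ S, ∀ y ∈ S, cmap ω (q x) (q y) = 0) :
    ∃ k, Trivializes ω S k ∧ ∀ x y, q x = 0 → q y = 0 → k x y = 0 := by
  have hqp : ∀ x, p (q x) = 0 := fun x => by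
    have := hpq (p x)
    rw [hpp, add_zero] at this
    have h := congrArg p (hpq x)
    rwa [map_add, this, add_eq_left] at h
  have hqq : ∀ x, q (q x) = q x := fun x => by
    have := hpq (q x)
    rwa [hqp, zero_add] at this
  have hpx : ∀ x, p (p x) = p x := fun x => by
    have := hpq (p x)
    rwa [hpp, add_zero] at this
  have hval : ∀ a b a' b' : G, SkeletalModel.Hom.val
      (tensorμ (C := SkeletalModel ω) ⟨a⟩ ⟨b⟩ ⟨a'⟩ ⟨b'⟩) =
      hmap ω a b (a' + b') - hmap ω b a' b' + cmap ω b a' + hmap ω a' b b'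
        - hmap ω a a' (b + b') := by
    intro a b a' b'
    have hβ : SkeletalModel.Hom.val (β_ (⟨b⟩ : SkeletalModel ω) ⟨a'⟩).hom = cmap ω b a' := rfl
    simp only [tensorμ, SkeletalModel.val_comp, SkeletalModel.val_whiskerLeft,
      SkeletalModel.val_whiskerRight, SkeletalModel.val_associator_hom,
      SkeletalModel.val_associator_inv, SkeletalModel.of_tensor, hβ]
    abel
  set t : G → G → G → G → M := fun a b a' b' => hmap ω a b (a' + b') - hmap ω b a' b' +
    cmap ω b a' + hmap ω a' b b' - hmap ω a a' (b + b') with ht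
  -- Coherence of the interchange: h on the sums is h on the a's plus h on the b's plus the
  -- coboundary of -t. Hence the sign in `k₁`.
  have hassoc : ∀ a b a' b' a'' b'' : G,
      t a b a' b' + t (a + a') (b + b') a'' b'' + hmap ω a a' a'' + hmap ω b b' b'' =
      hmap ω (a + b) (a' + b') (a'' + b'') + t a' b' a'' b'' + t a b (a' + a'') (b' + b'') := by
    intro a b a' b' a'' b''
    have := congrArg SkeletalModel.Hom.val (tensor_associativity (C := SkeletalModel ω)
      ⟨a⟩ ⟨b⟩ ⟨a'⟩ ⟨b'⟩ ⟨a''⟩ ⟨b''⟩)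
    simp only [SkeletalModel.val_comp, SkeletalModel.val_whiskerLeft,
      SkeletalModel.val_tensorHom,
      SkeletalModel.val_whiskerRight, SkeletalModel.val_associator_hom, hval,
      SkeletalModel.of_tensor] at this
    simp only [ht, add_assoc] at this ⊢
    linear_combination (norm := abel) this
  set k₁ : G → G → M := fun x y => - t (p x) (q x) (p y) (q y) with hk₁
  have k₁q : ∀ x y, q x = 0 → q y = 0 → k₁ x y = 0 := fun x y hx hy => by
    simp [hk₁, ht, hx, hy, h_right_zero, h_mid_zero, c_left_zero]
  have k₁p : ∀ x y, p x = 0 → p y = 0 → k₁ x y = 0 := fun x y hx hy => by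
    simp [hk₁, ht, hx, hy, h_mid_zero, h_left_zero, c_right_zero]
  have hk₁n : IsNormalized k₁ := by
    constructor <;> intro x <;>
    simp [hk₁, ht, h_right_zero, h_mid_zero, h_left_zero, c_left_zero, c_right_zero]
  set ω' := ω - coboundary k₁ hk₁n with hω'
  have h' : ∀ x ∈ S, ∀ y ∈ S, ∀ z ∈ S, hmap ω' x y z = 0 := fun x hx y hy z hz => by
    have := hassoc (p x) (q x) (p y) (q y) (p z) (q z)
    rw [h1 x hx y hy z hz, h2 x hx y hy z hz, hpq, hpq, hpq] at this
    simp only [hω', hmap_sub_coboundary, hk₁, map_add]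
    linear_combination (norm := abel) -this
  have hb := fun {x y z : G} (hx : x ∈ S) (hy : y ∈ S) (hz : z ∈ S) =>
    isBilinear_of_h_eq_zero ω' S h' hx hy hz
  have hc : ∀ x ∈ S, cmap ω' x x = 0 := fun x hx => by simp [hω', hω x hx]
  have hanti : ∀ x ∈ S, ∀ y ∈ S, cmap ω' x y = - cmap ω' y x := fun x hx y hy => by
    have := hc (x + y) (add_mem hx hy)
    rw [(hb hx hy (add_mem hx hy)).1, (hb hx hx hy).2, (hb hy hx hy).2, hc x hx, hc y hy, zero_add,
      add_zero] at this
    exact eq_neg_of_add_eq_zero_left this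
  have hcp : ∀ x ∈ S, ∀ y ∈ S, cmap ω' (p x) (p y) = 0 := fun x hx y hy => by
    simp [hω', c1 x hx y hy, k₁q _ _ (hpp x) (hpp y), k₁q _ _ (hpp y) (hpp x)]
  have hcq : ∀ x ∈ S, ∀ y ∈ S, cmap ω' (q x) (q y) = 0 := fun x hx y hy => by
    simp [hω', c2 x hx y hy, k₁p _ _ (hqp x) (hqp y), k₁p _ _ (hqp y) (hqp x)]
  have hdec : ∀ x ∈ S, ∀ y ∈ S, cmap ω' x y = cmap ω' (p x) (q y) - cmap ω' (p y) (q x) := by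
    intro x hx y hy
    conv_lhs => rw [← hpq x, ← hpq y]
    rw [(hb (hp x hx) (hq x hx) (add_mem (hp y hy) (hq y hy))).1,
      (hb (hp x hx) (hp y hy) (hq y hy)).2, (hb (hq x hx) (hp y hy) (hq y hy)).2,
      hcp x hx y hy, hcq x hx y hy, hanti _ (hq x hx) _ (hp y hy)]
    abel
  -- This map is bilinear on S, so it contributes nothing to h there; its antisymmetrization is the
  -- mixed part of c, which by `hdec` is all of c.
  refine ⟨_, Trivializes.add (k' := fun x y => - cmap ω' (p x) (q y)) hk₁n
    ⟨⟨fun x => ?_, fun y => ?_⟩, ?_, ?_⟩, ?_⟩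
  · simp [c_right_zero]
  · simp [c_left_zero]
  · intro x hx y hy z hz
    rw [h' x hx y hy z hz, map_add, map_add, (hb (hp x hx) (hp y hy) (hq z hz)).1,
      (hb (hp x hx) (hq y hy) (hq z hz)).2]
    abel
  · intro x hx y hy
    rw [hdec x hx y hy]
    abel
  · intro x y hx hy
    simp [k₁q x y hx hy, hy, c_right_zero]

end Splitting

section Splitting

variable {G : Type u} {M : Type v} [AddCommGroup G] [AddCommGroup M]

/-! ### Free abelian groups -/

/-- The subgroup of the free abelian group on `I` generated by `J`. -/
def supportedIn {I : Type*} (J : Set I) : AddSubgroup (I →₀ ℤ) where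
  carrier := {x | ∀ j, j ∉ J → x j = 0}
  zero_mem' := by simp
  add_mem' hx hy j hj := by simp [hx j hj, hy j hj]
  neg_mem' hx j hj := by simp [hx j hj]

/-- After subtracting k, the cocycle vanishes on the span of J; a trivialization on the line spanned
by i, read off the i-th coordinate, makes it vanish there too. The direct sum is then handled by
`exists_trivializes_product`. Agreement with k on the span of J is the order relation of the Zorn
argument. -/
lemma exists_trivializes_insert {I : Type*} (ω : Z3ab (I →₀ ℤ) M) (hω : ∀ x, cmap ω x x = 0)
    (J : Set I) (k : (I →₀ ℤ) → (I →₀ ℤ) → M) (hk : Trivializes ω (supportedIn J) k)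
    (i : I) (hi : i ∉ J) :
    ∃ k', Trivializes ω (supportedIn (insert i J)) k' ∧
      ∀ x ∈ supportedIn J, ∀ y ∈ supportedIn J, k x y = k' x y := by
  classical
  set k₀ : (I →₀ ℤ) → (I →₀ ℤ) → M := fun x y =>
    if x ∈ supportedIn J ∧ y ∈ supportedIn J then k x y else 0 with hk₀
  have hk₀n : IsNormalized k₀ := by
    refine ⟨fun x => ?_, fun x => ?_⟩ <;>
    simp [hk₀, hk.normalized.1, hk.normalized.2]
  have hk₀J : ∀ x ∈ supportedIn J, ∀ y ∈ supportedIn J, k₀ x y = k x y := fun x hx y hy => by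
    simp [hk₀, hx, hy]
  set ω₀ := ω - coboundary k₀ hk₀n with hω₀
  have hω₀h : ∀ x ∈ supportedIn J, ∀ y ∈ supportedIn J, ∀ z ∈ supportedIn J,
      hmap ω₀ x y z = 0 := fun x hx y hy z hz => by
    simp [hω₀, hk.h_eq x hx y hy z hz, hk₀J, hx, hy, hz, add_mem]
  have hω₀c : ∀ x ∈ supportedIn J, ∀ y ∈ supportedIn J, cmap ω₀ x y = 0 := fun x hx y hy => by
    simp [hω₀, hk.c_eq x hx y hy, hk₀J, hx, hy]
  obtain ⟨κ, hκ⟩ := exists_trivializes_int (pullback (Finsupp.singleAddHom i) ω₀)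
    (by simp [hω₀, hω])
  set k₁ : (I →₀ ℤ) → (I →₀ ℤ) → M := fun x y => κ (x i) (y i) with hk₁
  have hk₁n : IsNormalized k₁ := by
    refine ⟨fun x => ?_, fun x => ?_⟩ <;> simp [hk₁, hκ.normalized.1, hκ.normalized.2]
  set ω₁ := ω₀ - coboundary k₁ hk₁n with hω₁
  have hxi : ∀ x ∈ supportedIn J, x i = 0 := fun x hx => hx i hi
  have hk₁J : ∀ x y, x i = 0 → y i = 0 → k₁ x y = 0 := fun x y hx hy => by
    simp [hk₁, hx, hy, hκ.normalized.1]
  set q : (I →₀ ℤ) →+ (I →₀ ℤ) := (Finsupp.singleAddHom i).comp (Finsupp.applyAddHom i) with hq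
  have hqx : ∀ x, q x = Finsupp.single i (x i) := fun x => rfl
  have hpJ : ∀ x ∈ supportedIn (insert i J), x - q x ∈ supportedIn J := fun x hx j hj => by
    by_cases hij : i = j
    · subst hij; simp [hqx]
    · have : x j = 0 := hx j (by simp [Ne.symm hij, hj])
      simp [hqx, hij, this]
  have hJJ : ∀ x ∈ supportedIn J, x ∈ supportedIn (insert i J) := fun x hx j hj =>
    hx j fun h => hj (Set.mem_insert_of_mem i h)
  obtain ⟨k₂, hk₂, hk₂J⟩ := exists_trivializes_product ω₁ (AddMonoidHom.id _ - q) q (by simp)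
    (supportedIn (insert i J)) (fun x hx => hJJ _ (hpJ x hx))
    (fun x hx j hj => by
      have : i ≠ j := fun h => hj (by simp [h])
      simp [hqx, this])
    (fun x => by simp [hqx]) (fun x _ => by simp [hω₁, hω₀, hω])
    (fun x hx y hy z hz => by
      have hx := hpJ x hx; have hy := hpJ y hy; have hz := hpJ z hz
      simp only [AddMonoidHom.sub_apply, AddMonoidHom.id_apply]
      generalize x - q x = x at *; generalize y - q y = y at *; generalize z - q z = z at *
      simp [hω₁, hω₀h x hx y hy z hz, hk₁J, hxi, hx, hy, hz])
    (fun x hx y hy z hz => by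
      have := hκ.h_eq (x i) trivial (y i) trivial (z i) trivial
      simp only [hmap_pullback, Finsupp.singleAddHom_apply] at this
      simp [hω₁, hqx, this, hk₁])
    (fun x hx y hy => by
      have hx := hpJ x hx; have hy := hpJ y hy
      simp only [AddMonoidHom.sub_apply, AddMonoidHom.id_apply]
      generalize x - q x = x at *; generalize y - q y = y at *
      simp [hω₁, hω₀c x hx y hy, hk₁J, hxi, hx, hy])
    (fun x hx y hy => by
      have := hκ.c_eq (x i) trivial (y i) trivial
      simp only [cmap_pullback, Finsupp.singleAddHom_apply] at this
      simp [hω₁, hqx, this, hk₁])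
  refine ⟨_, (hk₂.add hk₁n).add hk₀n, fun x hx y hy => ?_⟩
  rw [hk₀J x hx y hy, hk₁J x y (hxi x hx) (hxi y hy),
    hk₂J x y (by simp [hqx, hxi x hx]) (by simp [hqx, hxi y hy])]
  simp

/-- Zorn's lemma for pairs of a set J of generators and a trivialization on its span, ordered by
extension. A maximal J contains every generator by `exists_trivializes_insert`. -/
lemma exists_trivializes_finsupp {I : Type*} (ω : Z3ab (I →₀ ℤ) M) (hω : ∀ x, cmap ω x x = 0) :
    ∃ k, Trivializes ω ⊤ k := by
  classical
  let P : Type _ := {a : Set I × ((I →₀ ℤ) → (I →₀ ℤ) → M) // Trivializes ω (supportedIn a.1) a.2}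
  let r : P → P → Prop := fun a b => a.1.1 ⊆ b.1.1 ∧
    ∀ x ∈ supportedIn a.1.1, ∀ y ∈ supportedIn a.1.1, a.1.2 x y = b.1.2 x y
  have mono : ∀ {J J' : Set I}, J ⊆ J' → ∀ x ∈ supportedIn J, x ∈ supportedIn J' :=
    fun h x hx j hj => hx j fun h' => hj (h h')
  have : Nonempty P := ⟨⟨(∅, fun _ _ => 0), by
    have h0 : ∀ x ∈ supportedIn (∅ : Set I), x = 0 :=
      fun x hx => Finsupp.ext fun j => hx j (by simp)
    refine ⟨⟨by simp, by simp⟩, fun x hx y hy z hz => ?_, fun x hx y hy => ?_⟩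
    · simp [h0 x hx, h_left_zero]
    · simp [h0 x hx, c_left_zero]⟩⟩
  obtain ⟨m, hm⟩ := exists_maximal_of_nonempty_chains_bounded (r := r)
    (fun c hc hne => by
      have htot : ∀ a ∈ c, ∀ b ∈ c, r a b ∨ r b a := fun a ha b hb => by
        rcases eq_or_ne a b with rfl | hab
        · exact Or.inl ⟨subset_rfl, fun _ _ _ _ => rfl⟩
        · exact hc ha hb hab
      set J : Set I := ⋃ a ∈ c, a.1.1 with hJ
      -- Supports are finite, so every triple over the union already lives over one member of the
      -- chain, where the identities are known.
      have hfin : ∀ x ∈ supportedIn J, ∀ y ∈ supportedIn J, ∀ z ∈ supportedIn J, ∃ a ∈ c,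
          x ∈ supportedIn a.1.1 ∧ y ∈ supportedIn a.1.1 ∧ z ∈ supportedIn a.1.1 := by
        intro x hx y hy z hz
        obtain ⟨a, ha, hs⟩ := DirectedOn.exists_mem_subset_of_finset_subset_biUnion
          (f := fun a : P => a.1.1) (s := x.support ∪ y.support ∪ z.support) hne
          (fun a ha b hb => (htot a ha b hb).elim (fun h => ⟨b, hb, h.1, subset_rfl⟩)
            fun h => ⟨a, ha, subset_rfl, h.1⟩)
          (fun j hj => by
            by_contra hjJ
            simp [hx j hjJ, hy j hjJ, hz j hjJ] at hj)
        refine ⟨a, ha, fun j hj => ?_, fun j hj => ?_, fun j hj => ?_⟩ <;>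
        · by_contra hne
          exact hj (hs (by simp [hne]))
      let k : (I →₀ ℤ) → (I →₀ ℤ) → M := fun x y =>
        if h : ∃ a ∈ c, x ∈ supportedIn a.1.1 ∧ y ∈ supportedIn a.1.1 then h.choose.1.2 x y else 0
      have hk : ∀ a ∈ c, ∀ x ∈ supportedIn a.1.1, ∀ y ∈ supportedIn a.1.1, k x y = a.1.2 x y := by
        intro a ha x hx y hy
        have h : ∃ a ∈ c, x ∈ supportedIn a.1.1 ∧ y ∈ supportedIn a.1.1 := ⟨a, ha, hx, hy⟩
        simp only [k, dif_pos h]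
        obtain ⟨h1, h2, h3⟩ := h.choose_spec
        rcases htot _ ha _ h1 with h' | h'
        · exact (h'.2 x hx y hy).symm
        · exact h'.2 x h2 y h3
      refine ⟨⟨(J, k), ⟨⟨fun x => ?_, fun x => ?_⟩, ?_, ?_⟩⟩, fun a ha =>
        ⟨Set.subset_biUnion_of_mem (u := fun a : P => a.1.1) ha, fun x hx y hy =>
          (hk a ha x hx y hy).symm⟩⟩
      · simp only [k]
        split_ifs with h
        · exact h.choose.2.normalized.1 x
        · rfl
      · simp only [k]
        split_ifs with h
        · exact h.choose.2.normalized.2 x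
        · rfl
      · intro x hx y hy z hz
        obtain ⟨a, ha, hx, hy, hz⟩ := hfin x hx y hy z hz
        dsimp only
        rw [hk a ha y hy z hz, hk a ha _ (add_mem hx hy) z hz, hk a ha x hx _ (add_mem hy hz),
          hk a ha x hx y hy]
        exact a.2.h_eq x hx y hy z hz
      · intro x hx y hy
        obtain ⟨a, ha, hx, hy, -⟩ := hfin x hx y hy y hy
        dsimp only
        rw [hk a ha x hx y hy, hk a ha y hy x hx]
        exact a.2.c_eq x hx y hy)
    (fun {a b c} hab hbc => ⟨hab.1.trans hbc.1, fun x hx y hy =>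
      (hab.2 x hx y hy).trans (hbc.2 x (mono hab.1 x hx) y (mono hab.1 y hy))⟩)
  have huniv : ∀ i, i ∈ m.1.1 := fun i => by
    by_contra hi
    obtain ⟨k', hk', hext⟩ := exists_trivializes_insert ω hω m.1.1 m.1.2 m.2 i hi
    exact hi ((hm ⟨(insert i m.1.1, k'), hk'⟩ ⟨Set.subset_insert _ _, hext⟩).1
      (Set.mem_insert _ _))
  have htop : ∀ x, x ∈ supportedIn m.1.1 := fun x j hj => absurd (huniv j) hj
  exact ⟨m.1.2, m.2.normalized, fun x _ y _ z _ => m.2.h_eq x (htop x) y (htop y) z (htop z),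
    fun x _ y _ => m.2.c_eq x (htop x) y (htop y)⟩

/-! ### Symmetric 2-cocycles with divisible coefficients -/

/-- Normalized symmetric 2-cocycles. -/
structure IsSymmetricCocycle (k : G → G → M) : Prop where
  zero : ∀ x, k x 0 = 0
  symm : ∀ x y, k x y = k y x
  cocycle : ∀ x y z, k x y + k (x + y) z = k y z + k x (y + z)

/-- The extension of `G` by `M` defined by a symmetric 2-cocycle. -/
@[ext]
structure TwistedSum (k : G → G → M) where
  fst : M
  snd : G

/-- The group law of the extension defined by a symmetric 2-cocycle. -/
@[reducible]
def TwistedSum.addCommGroup {k : G → G → M} (hk : IsSymmetricCocycle k) :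
    AddCommGroup (TwistedSum k) :=
  letI : Add (TwistedSum k) := ⟨fun a b => ⟨a.1 + b.1 + k a.2 b.2, a.2 + b.2⟩⟩
  letI : Zero (TwistedSum k) := ⟨⟨0, 0⟩⟩
  letI : Neg (TwistedSum k) := ⟨fun a => ⟨-a.1 - k (-a.2) a.2, -a.2⟩⟩
  have assoc : ∀ a b c : TwistedSum k, a + b + c = a + (b + c) := fun a b c =>
    TwistedSum.ext (by
      change a.1 + b.1 + k a.2 b.2 + c.1 + k (a.2 + b.2) c.2 =
        a.1 + (b.1 + c.1 + k b.2 c.2) + k a.2 (b.2 + c.2)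
      linear_combination (norm := abel) hk.cocycle a.2 b.2 c.2) (add_assoc a.2 b.2 c.2)
  have comm : ∀ a b : TwistedSum k, a + b = b + a := fun a b =>
    TwistedSum.ext (by
      change a.1 + b.1 + k a.2 b.2 = b.1 + a.1 + k b.2 a.2
      rw [hk.symm, add_comm a.1]) (add_comm a.2 b.2)
  have add_zero : ∀ a : TwistedSum k, a + 0 = a := fun a =>
    TwistedSum.ext (by
      change a.1 + 0 + k a.2 0 = a.1
      rw [hk.zero, _root_.add_zero, _root_.add_zero]) (_root_.add_zero a.2)
  { add_assoc := assoc
    add_comm := comm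
    add_zero := add_zero
    zero_add := fun a => (comm 0 a).trans (add_zero a)
    neg_add_cancel := fun a => TwistedSum.ext (by
      change -a.1 - k (-a.2) a.2 + a.1 + k (-a.2) a.2 = 0
      abel) (neg_add_cancel a.2)
    nsmul := nsmulRec
    zsmul := zsmulRec }

/-- The extension of G by M splits because M is injective: a retraction ρ onto M exists, and f(x) =
ρ(0, x). -/
lemma IsSymmetricCocycle.exists_eq {k : G → G → M} (hk : IsSymmetricCocycle k)
    (hM : Module.Baer ℤ M) : ∃ f : G → M, f 0 = 0 ∧ ∀ x y, k x y = f y - f (x + y) + f x := by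
  let _ := TwistedSum.addCommGroup hk
  have hadd : ∀ a b : TwistedSum k, a + b = ⟨a.1 + b.1 + k a.2 b.2, a.2 + b.2⟩ := fun _ _ => rfl
  let i : M →+ TwistedSum k := AddMonoidHom.mk' (fun m => ⟨m, 0⟩) fun m m' => by
    simp [hadd, hk.zero]
  obtain ⟨ρ, hρ⟩ := hM.extension_property_addMonoidHom i
    (fun m m' h => congrArg TwistedSum.fst h) (AddMonoidHom.id M)
  have hρi : ∀ m, ρ ⟨m, 0⟩ = m := fun m => DFunLike.congr_fun hρ m
  refine ⟨fun x => ρ ⟨0, x⟩, hρi 0, fun x y => ?_⟩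
  have h1 : (⟨0, x⟩ + ⟨0, y⟩ : TwistedSum k) = ⟨k x y, 0⟩ + ⟨0, x + y⟩ := by
    simp [hadd, hk.symm 0, hk.zero]
  have h2 := congrArg ρ h1
  rw [map_add, map_add, hρi] at h2
  linear_combination (norm := abel) -h2

/-! ### Descent to quotients of free groups -/

/-- The coboundary of a one-variable function is a symmetric 2-cocycle, so it affects neither h nor
c. This is the freedom used below to normalize trivializations. -/
lemma Trivializes.sub {ω : Z3ab G M} {S : AddSubgroup G} {k : G → G → M}
    (hk : Trivializes ω S k) (f : G → M) (hf : f 0 = 0) :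
    Trivializes ω S (fun x y => k x y - (f y - f (x + y) + f x)) where
  normalized := ⟨fun x => by simp [hk.normalized.1, hf], fun x => by simp [hk.normalized.2, hf]⟩
  h_eq x hx y hy z hz := by
    rw [hk.h_eq x hx y hy z hz, add_assoc x y z]; abel
  c_eq x hx y hy := by
    rw [hk.c_eq x hx y hy, add_comm x y]; abel

/-- On the kernel of π the pulled-back h and c vanish, so k is a symmetric 2-cocycle there and
splits. Two corrections by one-variable functions make k vanish whenever one argument lies in the
kernel; it then depends only on the images in G. -/
lemma Trivializes.descend {F : Type*} [AddCommGroup F] (π : F →+ G)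
    (hπ : Function.Surjective π) (hM : Module.Baer ℤ M) {ω : Z3ab G M} {k : F → F → M}
    (hk : Trivializes (pullback π ω) ⊤ k) : ∃ k', Trivializes ω ⊤ k' := by
  classical
  obtain ⟨s, hs0, hs⟩ : ∃ s : G → F, s 0 = 0 ∧ ∀ g, π (s g) = g := by
    choose s hs using hπ
    refine ⟨fun g => if g = 0 then 0 else s g, by simp, fun g => ?_⟩
    by_cases h : g = 0 <;> simp [h, hs]
  have hh := fun {k : F → F → M} (hk : Trivializes (pullback π ω) ⊤ k) (x y z : F) =>
    hk.h_eq x trivial y trivial z trivial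
  have hc := fun {k : F → F → M} (hk : Trivializes (pullback π ω) ⊤ k) (x y : F) =>
    hk.c_eq x trivial y trivial
  simp only [hmap_pullback, cmap_pullback] at hh hc
  have hR : IsSymmetricCocycle (fun x y : π.ker => k x y) := by
    refine ⟨fun x => hk.normalized.1 x, fun x y => ?_, fun x y z => ?_⟩
    · have := hc hk x y
      rw [π.mem_ker.1 x.2, c_left_zero] at this
      exact (sub_eq_zero.1 this.symm).symm
    · have := hh hk x y z
      rw [π.mem_ker.1 x.2, h_left_zero] at this
      dsimp only [AddSubgroup.coe_add]
      linear_combination (norm := abel) this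
  obtain ⟨f, hf0, hf⟩ := hR.exists_eq hM
  have hk₁ := hk.sub (fun x => if h : x ∈ π.ker then f ⟨x, h⟩ else 0) (by
    rw [dif_pos (zero_mem _)]; exact hf0)
  set k₁ := fun x y => k x y - ((if h : y ∈ π.ker then f ⟨y, h⟩ else 0) -
    (if h : x + y ∈ π.ker then f ⟨x + y, h⟩ else 0) + (if h : x ∈ π.ker then f ⟨x, h⟩ else 0))
    with hk₁def
  have k₁R : ∀ x ∈ π.ker, ∀ y ∈ π.ker, k₁ x y = 0 := fun x hx y hy => by
    have := hf ⟨x, hx⟩ ⟨y, hy⟩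
    simp only [hk₁def]
    rw [dif_pos hx, dif_pos hy, dif_pos (add_mem hx hy)]
    simp only at this
    rw [this]; simp
  have hρ : ∀ x, - s (π x) + x ∈ π.ker := fun x => by simp [AddMonoidHom.mem_ker, hs]
  -- The function is chosen so that the new map vanishes on pairs (s g, r) with r in the kernel: at
  -- s g + r it equals -k₁(s g, r), and at s g and at r it is 0.
  have hk₂ := hk₁.sub (fun x => -k₁ (s (π x)) (- s (π x) + x)) (by simp [hs0, hk₁.normalized.1])
  set k₂ := fun x y => k₁ x y - (-k₁ (s (π y)) (- s (π y) + y) -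
    -k₁ (s (π (x + y))) (- s (π (x + y)) + (x + y)) + -k₁ (s (π x)) (- s (π x) + x)) with hk₂def
  have ks : ∀ g, ∀ r ∈ π.ker, k₂ (s g) r = 0 := fun g r hr => by
    have hr' : π r = 0 := hr
    simp [hk₂def, hr', hs0, hs, hk₁.normalized.1, hk₁.normalized.2]
  have kR : ∀ x ∈ π.ker, ∀ r ∈ π.ker, k₂ x r = 0 := fun x hx r hr => by
    have hx' : π x = 0 := hx
    have hr' : π r = 0 := hr
    simp [hk₂def, hx', hr', hs0, k₁R x hx r hr, hk₁.normalized.2]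
  clear_value k₂
  -- Writing x = s(π x) + r' with r' in the kernel, the h-identity reduces the claim to the pairs
  -- treated in `ks` and `kR`.
  have kr : ∀ x, ∀ r ∈ π.ker, k₂ x r = 0 := fun x r hr => by
    have := hh hk₂ (s (π x)) (- s (π x) + x) r
    rw [π.mem_ker.1 hr, h_right_zero, ks _ _ (add_mem (hρ x) hr), ks _ _ (hρ x),
      add_neg_cancel_left] at this
    rw [kR _ (hρ x) r hr] at this
    simpa using this
  have kl : ∀ x, ∀ r ∈ π.ker, k₂ r x = 0 := fun x r hr => by
    have := hc hk₂ x r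
    rw [π.mem_ker.1 hr, c_right_zero, kr x r hr] at this
    simpa using this.symm
  have k_right : ∀ x y, ∀ r ∈ π.ker, k₂ x (y + r) = k₂ x y := fun x y r hr => by
    have := hh hk₂ x y r
    rw [π.mem_ker.1 hr, h_right_zero, kr _ r hr, kr _ r hr] at this
    linear_combination (norm := abel) -this
  have k_left : ∀ x y, ∀ r ∈ π.ker, k₂ (r + x) y = k₂ x y := fun x y r hr => by
    have := hh hk₂ r x y
    rw [π.mem_ker.1 hr, h_left_zero, kl _ r hr, kl _ r hr] at this
    linear_combination (norm := abel) this
  have hkey : ∀ x y, k₂ (s (π x)) (s (π y)) = k₂ x y := fun x y => by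
    have hx : x = (x - s (π x)) + s (π x) := by abel
    have hy : y = s (π y) + (- s (π y) + y) := by abel
    conv_rhs => rw [hx, hy]
    rw [k_right _ _ _ (hρ y), k_left _ _ _ (by simp [AddMonoidHom.mem_ker, hs])]
  refine ⟨fun x y => k₂ (s x) (s y), ⟨fun x => ?_, fun x => ?_⟩, fun x _ y _ z _ => ?_,
    fun x _ y _ => ?_⟩
  · simp only [hs0, hk₂.normalized.1]
  · simp only [hs0, hk₂.normalized.2]
  · have := hh hk₂ (s x) (s y) (s z)
    rw [hs, hs, hs] at this
    rw [this, ← hkey (s x + s y), ← hkey (s x) (s y + s z)]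
    simp only [map_add, hs]
  · have := hc hk₂ (s x) (s y)
    rwa [hs, hs] at this

lemma exists_trivializes_of_baer (hM : Module.Baer ℤ M) (ω : Z3ab G M)
    (hω : ∀ x, cmap ω x x = 0) : ∃ k, Trivializes ω ⊤ k := by
  let π : (G →₀ ℤ) →+ G := Finsupp.liftAddHom fun g => (zmultiplesHom G) g
  have hπ : Function.Surjective π := fun g => ⟨Finsupp.single g 1, by simp [π]⟩
  obtain ⟨k, hk⟩ := exists_trivializes_finsupp (pullback π ω) fun x => hω (π x)
  exact hk.descend π hπ hM

/-- M embeds by its characters in a power D of ℚ/ℤ, where the divisible case applies. Since h and c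
take values in M, the D-valued k is a symmetric 2-cocycle modulo M; D/M is divisible, so this is the
coboundary of some f. Subtracting the coboundary of a lift of f leaves a trivialization with values
in M. -/
lemma exists_trivializes (ω : Z3ab G M) (hω : ∀ x, cmap ω x x = 0) :
    ∃ k, Trivializes ω ⊤ k := by
  let D := CharacterModule M → AddCircle (1 : ℚ)
  let ψ : M →+ D := AddMonoidHom.pi fun χ => χ
  have hψ : Function.Injective ψ := (injective_iff_map_eq_zero ψ).2 fun a ha =>
    CharacterModule.eq_zero_of_character_apply fun χ => congrFun ha χ
  obtain ⟨k, hk⟩ := exists_trivializes_of_baer (Module.Baer.of_divisible D) (pushforward ψ ω)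
    fun x => (congrArg ψ (hω x)).trans (map_zero ψ)
  have hh := fun x y z => hk.h_eq x trivial y trivial z trivial
  have hc := fun x y => hk.c_eq x trivial y trivial
  change ∀ x y z, ψ (hmap ω x y z) = _ at hh
  change ∀ x y, ψ (cmap ω x y) = _ at hc
  let _ : DivisibleBy (D ⧸ ψ.range) ℤ :=
    Function.Surjective.divisibleBy (QuotientAddGroup.mk' ψ.range)
      (QuotientAddGroup.mk'_surjective _) fun a n => map_zsmul (QuotientAddGroup.mk' ψ.range) n a
  let p := QuotientAddGroup.mk' ψ.range
  have hp : ∀ m, p (ψ m) = 0 := fun m => (QuotientAddGroup.eq_zero_iff _).2 ⟨m, rfl⟩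
  have hsymm : IsSymmetricCocycle fun x y => p (k x y) := by
    refine ⟨fun x => by simp [hk.normalized.1], fun x y => ?_, fun x y z => ?_⟩
    · have := congrArg p (hc x y)
      rw [hp, map_sub] at this
      exact (sub_eq_zero.1 this.symm).symm
    · have := congrArg p (hh x y z)
      rw [hp] at this
      simp only [map_sub, map_add] at this
      linear_combination (norm := abel) this
  obtain ⟨f, hf0, hf⟩ := hsymm.exists_eq (Module.Baer.of_divisible _)
  obtain ⟨g, hg0, hg⟩ : ∃ g : G → D, g 0 = 0 ∧ ∀ x, p (g x) = f x := by
    classical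
    choose g hg using fun x => QuotientAddGroup.mk'_surjective ψ.range (f x)
    refine ⟨fun x => if x = 0 then 0 else g x, by simp, fun x => ?_⟩
    by_cases h : x = 0
    · simp [h, hf0]
    · simp only [if_neg h]; exact hg x
  have hk' := hk.sub g hg0
  have hker : ∀ x y, ∃ m, ψ m = k x y - (g y - g (x + y) + g x) := fun x y =>
    (QuotientAddGroup.eq_zero_iff (N := ψ.range) _).1 (by
      change p _ = 0
      simp only [map_sub, map_add, hg, hf, sub_self])
  choose k' hk'' using hker
  simp only [← hk''] at hk'
  refine ⟨k', ⟨fun x => hψ ?_, fun x => hψ ?_⟩, fun x _ y _ z _ => hψ ?_, fun x _ y _ => hψ ?_⟩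
  · simpa using hk'.normalized.1 x
  · simpa using hk'.normalized.2 x
  · simp only [map_sub, map_add]
    exact hk'.h_eq x trivial y trivial z trivial
  · simp only [map_sub]
    exact hk'.c_eq x trivial y trivial

/-- The Eilenberg–Mac Lane trace map is injective. -/
theorem trace_injective : Function.Injective (trace : H3ab G M →+ Quad G M) := by
  refine (injective_iff_map_eq_zero _).2 fun ξ hξ => ?_
  obtain ⟨ω, rfl⟩ := QuotientAddGroup.mk_surjective ξ
  exact (QuotientAddGroup.eq_zero_iff ω).2 ((mem_B3ab_iff ω).2
    (exists_trivializes ω fun x => congrFun (congrArg Subtype.val hξ) x))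

/-- The abelian 3-cocycle `(0, c)` for a bilinear map `c`. -/
def IsBilinear.cocycle {S : G → G → M} (hS : IsBilinear S) : Z3ab G M :=
  ⟨(fun _ _ _ => 0, S), by simp, by simp, fun x y z => by simp [hS.2, add_comm],
    fun x y z => by simp [hS.1]⟩

end Splitting

open Functor.LaxMonoidal Functor.OplaxMonoidal

/-! ### Inverses of braided equivalences -/

section Equivalence

universe v₁ v₂ u₁ u₂

variable {C : Type u₁} [Category.{v₁} C] [MonoidalCategory C] [BraidedCategory C]
  {D : Type u₂} [Category.{v₂} D] [MonoidalCategory D] [BraidedCategory D]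

/-- The inverse of a braided monoidal equivalence is braided monoidal. -/
lemma exists_braided_inverse (F : C ⥤ D) [hF : F.Braided] [F.IsEquivalence] :
    ∃ (e : C ≌ D) (_ : e.inverse.Braided), e.functor = F ∧
      ∀ X, Nonempty (F.obj (e.inverse.obj X) ≅ X) ∧
      ∀ (f : 𝟙_ C ⟶ 𝟙_ C) (g : 𝟙_ D ⟶ 𝟙_ D), ε F ≫ F.map f = g ≫ ε F →
        ε e.inverse ≫ e.inverse.map g = f ≫ ε e.inverse := by
  let e := F.asEquivalence
  let _ : e.functor.Braided := hF
  let _ : e.inverse.Monoidal := e.inverseMonoidal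
  have : e.toAdjunction.IsMonoidal := ⟨rfl, fun _ _ => rfl⟩
  -- The counit is monoidal. Identities about the inverse are checked after applying the faithful
  -- functor and composing with the counit, where `hμ` and `hε` evaluate them.
  have hμ : ∀ X Y : D, e.functor.map (μ e.inverse X Y) ≫ e.counit.app (X ⊗ Y) =
      δ e.functor _ _ ≫ (e.counit.app X ⊗ₘ e.counit.app Y) :=
    fun X Y => e.toAdjunction.map_μ_comp_counit_app_tensor X Y
  have hε : e.functor.map (ε e.inverse) ≫ e.counit.app (𝟙_ D) = η e.functor :=
    e.toAdjunction.map_ε_comp_counit_app_unit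
  refine ⟨e, { braided := fun X Y => ?_ }, rfl, fun X => ⟨⟨e.counitIso.app X⟩, fun f g h => ?_⟩⟩
  · apply e.functor.map_injective
    rw [← cancel_mono (e.counit.app (Y ⊗ X)), Functor.map_comp, Functor.map_comp,
      Category.assoc, Category.assoc, hμ]
    have h1 : e.functor.map (e.inverse.map (β_ X Y).hom) ≫ e.counit.app (Y ⊗ X) =
      e.counit.app (X ⊗ Y) ≫ (β_ X Y).hom := e.counit.naturality _
    rw [h1, reassoc_of% (hμ X Y), Functor.map_braiding]
    simp
  · apply e.functor.map_injective
    rw [← cancel_mono (e.counit.app (𝟙_ D)), Functor.map_comp, Functor.map_comp,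
      Category.assoc, Category.assoc, hε]
    have h1 : e.functor.map (e.inverse.map g) ≫ e.counit.app (𝟙_ D) =
      e.counit.app (𝟙_ D) ≫ g := e.counit.naturality _
    rw [h1, reassoc_of% hε]
    change ε e.functor ≫ e.functor.map f = g ≫ ε e.functor at h
    rw [← cancel_mono (ε e.functor), ← cancel_epi (ε e.functor)]
    simp [h]

end Equivalence

/-! ### The action of π₁ on objects -/

section Action

lemma Pi0.mk_eq_mk_iff {C : Type u} [Category.{v} C] {X Y : C} :
    Pi0.mk X = Pi0.mk Y ↔ Nonempty (X ≅ Y) :=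
  toSkeleton_eq_toSkeleton_iff

lemma Pi0.mk_surjective {C : Type u} [Category.{v} C] (x : Pi0 C) : ∃ X : C, Pi0.mk X = x :=
  ⟨Quotient.out (s := isIsomorphicSetoid C) x, Quotient.out_eq (s := isIsomorphicSetoid C) x⟩

variable {C : Type u} [Category.{v} C] [MonoidalCategory C]

/-- The action of the automorphisms of the unit object on an object. -/
def act (m : Pi1 C) (X : C) : X ⟶ X := (λ_ X).inv ≫ m.toAut.hom ▷ X ≫ (λ_ X).hom

lemma act_naturality (m : Pi1 C) {X Y : C} (f : X ⟶ Y) : f ≫ act m Y = act m X ≫ f := by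
  simp only [act, Category.assoc, ← leftUnitor_naturality, ← whisker_exchange_assoc]
  rw [leftUnitor_inv_naturality_assoc]

lemma act_unit (m : Pi1 C) : act m (𝟙_ C) = m.toAut.hom := by
  rw [act, unitors_equal, rightUnitor_naturality, ← unitors_equal, Iso.inv_hom_id_assoc]

lemma act_tensor_right (m : Pi1 C) (X Y : C) : act m (X ⊗ Y) = act m X ▷ Y := by
  simp [act]

lemma act_zero (X : C) : act 0 X = 𝟙 X := by
  have : (Pi1.toAut (0 : Pi1 C)).hom = 𝟙 _ := rfl
  simp [act, this]

lemma act_add (m n : Pi1 C) (X : C) : act (m + n) X = act m X ≫ act n X := by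
  -- Multiplication in `Aut` composes in the opposite order, so commutativity of unit endomorphisms
  -- is needed.
  have : (Pi1.toAut (m + n)).hom = m.toAut.hom ≫ n.toAut.hom := unit_endo_comm _ _
  simp [act, this]

lemma whiskerLeft_injective_of_inverse {X Y : C} (e : Y ⊗ X ≅ 𝟙_ C) {Z W : C} {f g : Z ⟶ W}
    (h : X ◁ f = X ◁ g) : f = g := by
  have h1 : (Y ⊗ X) ◁ f = (Y ⊗ X) ◁ g := by
    rw [tensor_whiskerLeft, tensor_whiskerLeft, h]
  have h2 : 𝟙_ C ◁ f = 𝟙_ C ◁ g := by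
    rw [← cancel_epi (e.hom ▷ Z), ← whisker_exchange, ← whisker_exchange, h1]
  simpa using h2

lemma toAut_hom_injective {m n : Pi1 C} (h : m.toAut.hom = n.toAut.hom) : m = n :=
  Iso.ext h

/-- The braiding exchanges the two factors, and the action is natural, so the right-hand statement
`act_tensor_right` transfers to the left. -/
lemma act_tensor_left [BraidedCategory C] (m : Pi1 C) (X Y : C) : act m (X ⊗ Y) = X ◁ act m Y := by
  rw [← cancel_mono (β_ X Y).hom, BraidedCategory.braiding_naturality_right, ← act_tensor_right,
    act_naturality]

variable [IsBraidedCategoricalGroup C]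

lemma whiskerLeft_injective (X : C) {Z W : C} {f g : Z ⟶ W} (h : X ◁ f = X ◁ g) : f = g := by
  obtain ⟨Y, ⟨e⟩⟩ := IsBraidedCategoricalGroup.exists_inverse X
  exact whiskerLeft_injective_of_inverse e h

lemma exists_act_of_iso {X : C} (e : X ≅ 𝟙_ C) (f : X ⟶ X) : ∃ m, f = act m X := by
  have := IsBraidedCategoricalGroup.isIso (e.inv ≫ f ≫ e.hom)
  let m : Pi1 C := Additive.ofMul (asIso (e.inv ≫ f ≫ e.hom) : Aut (𝟙_ C))
  refine ⟨m, ?_⟩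
  have h1 : act m (𝟙_ C) = e.inv ≫ f ≫ e.hom := act_unit m
  rw [← cancel_mono e.hom, ← act_naturality, h1, Iso.hom_inv_id_assoc]

variable [BraidedCategory C]

lemma whiskerRight_injective (X : C) {Z W : C} {f g : Z ⟶ W} (h : f ▷ X = g ▷ X) : f = g := by
  apply whiskerLeft_injective X
  rw [← cancel_mono (β_ X W).hom, BraidedCategory.braiding_naturality_right,
    BraidedCategory.braiding_naturality_right, h]

lemma act_injective (X : C) {m n : Pi1 C} (h : act m X = act n X) : m = n := by
  rw [act, act, cancel_epi, cancel_mono] at h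
  exact toAut_hom_injective (whiskerRight_injective X h)

/-- Tensoring with an inverse Y of X moves f to an object isomorphic to the unit, where
endomorphisms come from π₁; whiskering by Y is then cancelled. -/
lemma exists_act {X : C} (f : X ⟶ X) : ∃ m, f = act m X := by
  obtain ⟨Y, ⟨e⟩⟩ := IsBraidedCategoricalGroup.exists_inverse X
  obtain ⟨m, hm⟩ := exists_act_of_iso e (Y ◁ f)
  refine ⟨m, whiskerLeft_injective Y ?_⟩
  rw [hm, act_tensor_left]

end Action

/-! ### Skeletal categories with prescribed automorphisms -/

section Valuation

variable {D : Type u} [Category.{v} D] [MonoidalCategory D]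
  {M : Type w} [AddCommGroup M]

variable (D M) in
/-- An identification of all automorphism groups of a skeletal monoidal groupoid with `M`. -/
structure Valuation where
  val : ∀ {X Y : D}, (X ⟶ Y) → M
  eq_of_hom : ∀ {X Y : D}, (X ⟶ Y) → X = Y
  injective : ∀ {X Y : D} {f g : X ⟶ Y}, val f = val g → f = g
  hom : ∀ {X Y : D}, X = Y → M → (X ⟶ Y)
  val_hom : ∀ {X Y : D} (e : X = Y) (m : M), val (hom e m) = m
  val_id : ∀ X : D, val (𝟙 X) = 0
  val_comp : ∀ {X Y Z : D} (f : X ⟶ Y) (g : Y ⟶ Z), val (f ≫ g) = val f + val g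
  val_whiskerLeft : ∀ (X : D) {Y Z : D} (f : Y ⟶ Z), val (X ◁ f) = val f
  val_whiskerRight : ∀ {Y Z : D} (f : Y ⟶ Z) (X : D), val (f ▷ X) = val f

namespace Valuation

attribute [simp] val_hom val_id val_comp val_whiskerLeft val_whiskerRight

variable (V : Valuation D M)

@[simp] lemma val_inv {X Y : D} (e : X ≅ Y) : V.val e.inv = - V.val e.hom := by
  rw [eq_neg_iff_add_eq_zero, ← V.val_comp, e.inv_hom_id, V.val_id]

/-- The isomorphism with a given value. -/
@[simps] def iso {X Y : D} (e : X = Y) (m : M) : X ≅ Y where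
  hom := V.hom e m
  inv := V.hom e.symm (-m)
  hom_inv_id := V.injective (by simp)
  inv_hom_id := V.injective (by simp)

variable [BraidedCategory D] {G : Type*} [AddCommGroup G] (o : G → D)
  (o_add : ∀ x y, o (x + y) = o x ⊗ o y) (o_zero : o 0 = 𝟙_ D) (e₀ : M) (k : G → G → M)
  (hl : ∀ x, V.val (λ_ (o x)).hom = e₀ + k 0 x) (hr : ∀ x, V.val (ρ_ (o x)).hom = e₀ + k x 0)

include o_add o_zero hl hr in
-- Pentagon and hexagons give the cocycle equations, which survive adding the coboundary of any k.
-- The values of k on the axes absorb the unitors up to the common constant e₀, so that the triangle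
-- becomes h(x,0,z) = 0.
lemma cocycle_mem : ((fun x y z => V.val (α_ (o x) (o y) (o z)).hom +
      (k y z - k (x + y) z + k x (y + z) - k x y),
    fun x y => V.val (β_ (o x) (o y)).hom + (k y x - k x y)) :
      (G → G → G → M) × (G → G → M)) ∈ Z3ab G M := by
  refine ⟨fun u x y z => ?_, fun x z => ?_, fun x y z => ?_, fun x y z => ?_⟩
  · have := congrArg V.val (pentagon (o u) (o x) (o y) (o z))
    have e₁ : V.val (α_ (o (u + x)) (o y) (o z)).hom = V.val (α_ (o u ⊗ o x) (o y) (o z)).hom := by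
      rw [o_add]
    have e₂ : V.val (α_ (o u) (o (x + y)) (o z)).hom = V.val (α_ (o u) (o x ⊗ o y) (o z)).hom := by
      rw [o_add]
    have e₃ : V.val (α_ (o u) (o x) (o (y + z))).hom = V.val (α_ (o u) (o x) (o y ⊗ o z)).hom := by
      rw [o_add]
    simp only [val_comp, val_whiskerLeft, val_whiskerRight] at this
    simp only [add_assoc u x y, add_assoc x y z, e₁, e₂, e₃]
    linear_combination (norm := abel) this
  · have := congrArg V.val (triangle (o x) (o z))
    have e₁ : V.val (α_ (o x) (o 0) (o z)).hom = V.val (α_ (o x) (𝟙_ D) (o z)).hom := by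
      rw [o_zero]
    simp only [val_comp, val_whiskerLeft, val_whiskerRight, hl, hr] at this
    simp only [zero_add, add_zero, e₁]
    linear_combination (norm := abel) this
  · have := congrArg V.val (BraidedCategory.hexagon_forward (o x) (o y) (o z))
    have e₁ : V.val (β_ (o x) (o (y + z))).hom = V.val (β_ (o x) (o y ⊗ o z)).hom := by
      rw [o_add]
    simp only [val_comp, val_whiskerLeft, val_whiskerRight] at this
    simp only [add_comm z x, add_comm y x, e₁]
    linear_combination (norm := abel) this
  · have := congrArg V.val (BraidedCategory.hexagon_reverse (o x) (o y) (o z))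
    have e₁ : V.val (β_ (o (x + y)) (o z)).hom = V.val (β_ (o x ⊗ o y) (o z)).hom := by
      rw [o_add]
    simp only [val_comp, val_whiskerLeft, val_whiskerRight, val_inv] at this
    simp only [add_comm z x, add_comm z y, e₁]
    linear_combination (norm := abel) this

end Valuation

end Valuation

/-! ### Braided functors from skeletal models -/

section Valuation

variable {D : Type*} [Category* D] [MonoidalCategory D]
  {M : Type*} [AddCommGroup M] {G : Type*} [AddCommGroup G]

namespace Valuation

variable (V : Valuation D M) (o : G → D) (ω : Z3ab G M)

/-- The functor from a skeletal model defined by a valuation. -/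
@[simps] def functor : SkeletalModel ω ⥤ D where
  obj X := o X.of
  map f := V.hom (congrArg (fun X => o X.of) (SkeletalModel.Hom.eq f)) (SkeletalModel.Hom.val f)
  map_id X := V.injective (by simp)
  map_comp f g := V.injective (by simp)

instance : (V.functor o ω).Faithful where
  map_injective h := SkeletalModel.hom_ext' (by
    have := congrArg V.val h
    dsimp only [functor] at this
    simpa using this)

lemma functor_full (ho : Function.Injective o) : (V.functor o ω).Full where
  map_surjective f :=
    ⟨SkeletalModel.Hom.mk (SkeletalModel.ext (ho (V.eq_of_hom f))) (V.val f),
      V.injective (V.val_hom _ _)⟩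

lemma functor_essSurj (ho : Function.Surjective o) : (V.functor o ω).EssSurj where
  mem_essImage X := by
    obtain ⟨x, rfl⟩ := ho X
    exact ⟨⟨x⟩, ⟨Iso.refl _⟩⟩

lemma functor_isEquivalence (ho : Function.Bijective o) : (V.functor o ω).IsEquivalence :=
  have := V.functor_full o ω ho.1
  have := V.functor_essSurj o ω ho.2
  {}

/-- In this lemma and the next five, objects are variables with their equalities as hypotheses. The
axioms of a monoidal or braided functor then reduce to equations in M without transport along
`o_add`. -/
lemma whiskerRight_comp_eq {A B Z W W' : D} (e₁ : A = B) (e₂ : B ⊗ Z = W) (e₃ : A ⊗ Z = W')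
    (e₄ : W' = W) {a b c d : M} (h : a + b = c + d) :
    V.hom e₁ a ▷ Z ≫ V.hom e₂ b = V.hom e₃ c ≫ V.hom e₄ d :=
  V.injective (by simp [h])

lemma whiskerLeft_comp_eq {A B Z W W' : D} (e₁ : A = B) (e₂ : Z ⊗ B = W) (e₃ : Z ⊗ A = W')
    (e₄ : W' = W) {a b c d : M} (h : a + b = c + d) :
    Z ◁ V.hom e₁ a ≫ V.hom e₂ b = V.hom e₃ c ≫ V.hom e₄ d :=
  V.injective (by simp [h])

lemma associativity_eq {A B Z AB ABZ BZ W : D} (e₁ : A ⊗ B = AB) (e₂ : AB ⊗ Z = ABZ)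
    (e₃ : ABZ = W) (e₄ : B ⊗ Z = BZ) (e₅ : A ⊗ BZ = W) {a b c d f : M}
    (h : a + (b + c) = V.val (α_ A B Z).hom + (d + f)) :
    V.hom e₁ a ▷ Z ≫ V.hom e₂ b ≫ V.hom e₃ c = (α_ A B Z).hom ≫ A ◁ V.hom e₄ d ≫ V.hom e₅ f :=
  V.injective (by simp [h])

lemma left_unitality_eq {A B W : D} (e₁ : 𝟙_ D = B) (e₂ : B ⊗ A = W) (e₃ : W = A) {a b c : M}
    (h : V.val (λ_ A).hom = a + (b + c)) :
    (λ_ A).hom = V.hom e₁ a ▷ A ≫ V.hom e₂ b ≫ V.hom e₃ c :=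
  V.injective (by simp [h])

lemma right_unitality_eq {A B W : D} (e₁ : 𝟙_ D = B) (e₂ : A ⊗ B = W) (e₃ : W = A) {a b c : M}
    (h : V.val (ρ_ A).hom = a + (b + c)) :
    (ρ_ A).hom = A ◁ V.hom e₁ a ≫ V.hom e₂ b ≫ V.hom e₃ c :=
  V.injective (by simp [h])

lemma braiding_eq [BraidedCategory D] {A B W W' : D} (e₁ : A ⊗ B = W) (e₂ : W = W')
    (e₃ : B ⊗ A = W') {a b c : M} (h : a + b = V.val (β_ A B).hom + c) :
    V.hom e₁ a ≫ V.hom e₂ b = (β_ A B).hom ≫ V.hom e₃ c :=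
  V.injective (by simp [h])

variable [BraidedCategory D] {ω} (o_add : ∀ x y, o (x + y) = o x ⊗ o y) (o_zero : o 0 = 𝟙_ D)
  (e₀ : M) (k : G → G → M)
  (hl : ∀ x, V.val (λ_ (o x)).hom = e₀ + k 0 x) (hr : ∀ x, V.val (ρ_ (o x)).hom = e₀ + k x 0)
  (hh : ∀ x y z, hmap ω x y z = V.val (α_ (o x) (o y) (o z)).hom +
      (k y z - k (x + y) z + k x (y + z) - k x y))
  (hc : ∀ x y, cmap ω x y = V.val (β_ (o x) (o y)).hom + (k y x - k x y))

/-- The monoidal structure of `Valuation.functor`. -/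
def functorCoreMonoidal : (V.functor o ω).CoreMonoidal where
  εIso := V.iso o_zero.symm e₀
  μIso X Y := V.iso (o_add X.of Y.of).symm (k X.of Y.of)
  μIso_hom_natural_left {X Y} f Z := by
    obtain rfl := SkeletalModel.Hom.eq f
    exact V.whiskerRight_comp_eq _ _ _ _ (add_comm _ _)
  μIso_hom_natural_right {X Y} Z f := by
    obtain rfl := SkeletalModel.Hom.eq f
    exact V.whiskerLeft_comp_eq _ _ _ _ (add_comm _ _)
  associativity X Y Z := V.associativity_eq _ _ _ _ _ (by
    rw [SkeletalModel.val_associator_hom, hh, SkeletalModel.of_tensor, SkeletalModel.of_tensor]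
    change _ = V.val (α_ (o X.of) (o Y.of) (o Z.of)).hom + _
    abel)
  left_unitality X := V.left_unitality_eq _ _ _ (by
    rw [SkeletalModel.val_leftUnitor_hom, add_zero]
    exact hl X.of)
  right_unitality X := V.right_unitality_eq _ _ _ (by
    rw [SkeletalModel.val_rightUnitor_hom, add_zero]
    exact hr X.of)

/-- The braided structure of `Valuation.functor`. -/
@[reducible] def functorBraided : (V.functor o ω).Braided where
  toMonoidal := (V.functorCoreMonoidal o o_add o_zero e₀ k hl hr hh).toMonoidal
  braided X Y := V.braiding_eq _ _ _ (by
    change _ + cmap ω X.of Y.of = _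
    rw [hc]
    abel)

end Valuation

end Valuation

/-! ### Transport of braided monoidal structures -/

section TensorData

variable (C : Type u) [Category.{v} C] [MonoidalCategory C]

/-- A family of objects closed under tensor products up to chosen isomorphisms. -/
structure TensorData (ι : Type w) where
  obj : ι → C
  op : ι → ι → ι
  unit : ι
  tensorIso : ∀ i j, obj i ⊗ obj j ≅ obj (op i j)
  unitIso : 𝟙_ C ≅ obj unit

variable {C} {ι : Type w}

namespace TensorData

variable (P : TensorData C ι)

/-- The full subcategory on a family of objects, indexed by that family. -/
def Cat (_ : TensorData C ι) : Type w := ι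

instance : Category.{v} P.Cat := inferInstanceAs (Category (InducedCategory C P.obj))

/-- The inclusion of the full subcategory. -/
def forget : P.Cat ⥤ C := inducedFunctor P.obj

@[simp] lemma forget_obj (i : P.Cat) : P.forget.obj i = P.obj i := rfl

/-- The inclusion is fully faithful. -/
def fullyFaithful : P.forget.FullyFaithful := fullyFaithfulInducedFunctor P.obj

instance : P.forget.Full := P.fullyFaithful.full

instance : P.forget.Faithful := P.fullyFaithful.faithful

/-- Morphisms of the full subcategory. -/
def homMk {i j : P.Cat} (f : P.obj i ⟶ P.obj j) : i ⟶ j := P.fullyFaithful.preimage f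

/-- Isomorphisms of the full subcategory. -/
def isoMk {i j : P.Cat} (f : P.obj i ≅ P.obj j) : i ≅ j := P.fullyFaithful.preimageIso f

@[simp] lemma map_isoMk_hom {i j : P.Cat} (f : P.obj i ≅ P.obj j) :
    P.forget.map (P.isoMk f).hom = f.hom := rfl

instance : MonoidalCategoryStruct P.Cat where
  tensorObj i j := P.op i j
  whiskerLeft i _ _ f :=
    P.homMk ((P.tensorIso _ _).inv ≫ P.obj i ◁ P.forget.map f ≫ (P.tensorIso _ _).hom)
  whiskerRight f j :=
    P.homMk ((P.tensorIso _ _).inv ≫ P.forget.map f ▷ P.obj j ≫ (P.tensorIso _ _).hom)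
  tensorHom f g :=
    P.homMk ((P.tensorIso _ _).inv ≫ (P.forget.map f ⊗ₘ P.forget.map g) ≫ (P.tensorIso _ _).hom)
  tensorUnit := P.unit
  associator i j l := P.isoMk (((P.tensorIso _ _).symm ≪≫ ((P.tensorIso i j).symm ⊗ᵢ .refl _)) ≪≫
    α_ _ _ _ ≪≫ ((.refl _ ⊗ᵢ P.tensorIso j l) ≪≫ P.tensorIso _ _))
  leftUnitor _ := P.isoMk (((P.tensorIso _ _).symm ≪≫ (P.unitIso.symm ⊗ᵢ .refl _)) ≪≫ λ_ _)
  rightUnitor _ := P.isoMk (((P.tensorIso _ _).symm ≪≫ (.refl _ ⊗ᵢ P.unitIso.symm)) ≪≫ ρ_ _)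

/-- The inclusion respects the tensor structures. -/
def inducingData : Monoidal.InducingFunctorData P.forget where
  μIso i j := P.tensorIso i j
  εIso := P.unitIso
  whiskerLeft_eq _ _ _ _ := rfl
  whiskerRight_eq _ _ := rfl
  tensorHom_eq _ _ := rfl
  associator_eq _ _ _ := rfl
  leftUnitor_eq _ := rfl
  rightUnitor_eq _ := rfl

instance : MonoidalCategory P.Cat := Monoidal.induced P.forget P.inducingData

instance : P.forget.Monoidal := Monoidal.fromInducedMonoidal P.forget P.inducingData

lemma forget_μ (i j : P.Cat) : Functor.LaxMonoidal.μ P.forget i j = (P.tensorIso i j).hom := rfl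

variable [BraidedCategory C]

instance : BraidedCategory P.Cat :=
  .ofFaithful P.forget
    (fun i j => P.isoMk ((P.tensorIso i j).symm ≪≫ β_ _ _ ≪≫ P.tensorIso j i)) fun i j => by
    simp only [forget_μ, map_isoMk_hom, Iso.trans_hom, Iso.symm_hom, forget_obj]
    exact Iso.hom_inv_id_assoc _ _

instance : P.forget.Braided where
  braided i j := by
    change _ ≫ Iso.hom (_ ≪≫ _) = _
    simp only [forget_μ, Iso.trans_hom, Iso.symm_hom, forget_obj]
    exact Iso.hom_inv_id_assoc _ _

end TensorData

end TensorData

section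

variable {C : Type u} [Category.{v} C] [MonoidalCategory C]

lemma eqToHom_act_comp {X Y Z : C} (e : X = Y) (e' : Y = Z) (m n : Pi1 C) :
    (eqToHom e ≫ act m Y) ≫ eqToHom e' ≫ act n Z = eqToHom (e.trans e') ≫ act (m + n) Z := by
  subst e; subst e'
  simp [act_add]

/-- Source and target are members of families over ι, so that the single equality of indices can be
eliminated. -/
lemma eqToHom_act_whiskerLeft [BraidedCategory C] {ι : Type*} (T S : ι → C) (X : C)
    (ν : ∀ y, X ⊗ T y ≅ S y) {y z : ι} (e : y = z) (m : Pi1 C) :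
    (ν y).inv ≫ X ◁ (eqToHom (congrArg T e) ≫ act m (T z)) ≫ (ν z).hom =
      eqToHom (congrArg S e) ≫ act m (S z) := by
  subst e
  simp [← act_tensor_left, ← act_naturality]

lemma eqToHom_act_whiskerRight {ι : Type*} (T S : ι → C) (X : C)
    (ν : ∀ y, T y ⊗ X ≅ S y) {y z : ι} (e : y = z) (m : Pi1 C) :
    (ν y).inv ≫ (eqToHom (congrArg T e) ≫ act m (T z)) ▷ X ≫ (ν z).hom =
      eqToHom (congrArg S e) ≫ act m (S z) := by
  subst e
  simp [← act_tensor_right, ← act_naturality]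

/-- If the tensor constraints of K are equalities, the compatibility of K with associators writes
the image of the associator as a composite of `eqToHom`s. -/
lemma exists_map_associator_eq_eqToHom {D : Type*} [Category* D] [MonoidalCategory D] (K : C ⥤ D)
    [K.Monoidal] (hμ : ∀ X Y, ∃ e, μ K X Y = eqToHom e) {X Y Z : C}
    (hα : ∃ e, (α_ (K.obj X) (K.obj Y) (K.obj Z)).hom = eqToHom e) :
    ∃ e, K.map (α_ X Y Z).hom = eqToHom e := by
  have hδ : ∀ X Y, ∃ e, δ K X Y = eqToHom e := fun X Y => by
    obtain ⟨e, h⟩ := hμ X Y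
    refine ⟨e.symm, ?_⟩
    rw [← cancel_epi (μ K X Y), Functor.Monoidal.μ_δ, h]
    simp
  obtain ⟨e₁, h₁⟩ := hδ (X ⊗ Y) Z
  obtain ⟨e₂, h₂⟩ := hδ X Y
  obtain ⟨e₃, h₃⟩ := hα
  obtain ⟨e₄, h₄⟩ := hμ Y Z
  obtain ⟨e₅, h₅⟩ := hμ X (Y ⊗ Z)
  rw [Functor.Monoidal.map_associator, h₁, h₂, h₃, h₄, h₅, eqToHom_whiskerRight,
    whiskerLeft_eqToHom]
  exact ⟨e₁.trans ((congrArg (· ⊗ _) e₂).trans (e₃.trans ((congrArg (_ ⊗ ·) e₄).trans e₅))),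
    by simp⟩

end

/-! ### Cocycles from representatives of π₀ -/

section Existence

variable {C : Type u} [Category.{v} C] [MonoidalCategory C] [BraidedCategory C]
  [IsBraidedCategoricalGroup C] (T : Pi0 C → C) (μT : ∀ x y, T x ⊗ T y ≅ T (x + y))
  (εT : 𝟙_ C ≅ T 0)

/-- A choice of representatives of `π₀` and of isomorphisms between their tensor products. -/
noncomputable def TensorData.ofPi0 : TensorData C (Pi0 C) where
  obj := T
  op x y := x + y
  unit := 0
  tensorIso := μT
  unitIso := εT

variable {T} (hT : ∀ x, Pi0.mk (T x) = x)

include hT in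
-- Every morphism is invertible, so isomorphic representatives have equal indices, and by
-- `exists_act` the automorphisms of a representative are elements of π₁.
lemma exists_eqToHom_act {x y : Pi0 C} (f : T x ⟶ T y) :
    ∃ (m : Pi1 C) (e : x = y), f = eqToHom (congrArg T e) ≫ act m (T y) := by
  have := IsBraidedCategoricalGroup.isIso f
  have e : x = y := by
    rw [← hT x, ← hT y]
    exact Pi0.mk_eq_mk_iff.2 ⟨asIso f⟩
  subst e
  obtain ⟨m, rfl⟩ := exists_act f
  exact ⟨m, rfl, by simp⟩

lemma eq_of_eqToHom_act {x y : Pi0 C} {m n : Pi1 C} (e e' : x = y)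
    (h : eqToHom (congrArg T e) ≫ act m (T y) = eqToHom (congrArg T e') ≫ act n (T y)) :
    m = n := by
  rw [cancel_epi] at h
  exact act_injective _ h

/-- The element of `π₁` underlying a morphism between chosen representatives of `π₀`. -/
noncomputable def piVal {x y : (TensorData.ofPi0 T μT εT).Cat} (f : x ⟶ y) : Pi1 C :=
  (exists_eqToHom_act hT ((TensorData.ofPi0 T μT εT).forget.map f)).choose

lemma piVal_spec {x y : (TensorData.ofPi0 T μT εT).Cat} (f : x ⟶ y) :
    ∃ e : x = y, (TensorData.ofPi0 T μT εT).forget.map f =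
      eqToHom (congrArg T e) ≫ act (piVal μT εT hT f) (T y) :=
  (exists_eqToHom_act hT ((TensorData.ofPi0 T μT εT).forget.map f)).choose_spec

lemma piVal_eq {x y : (TensorData.ofPi0 T μT εT).Cat} (f : x ⟶ y) (m : Pi1 C) (e : x = y)
    (h : (TensorData.ofPi0 T μT εT).forget.map f = eqToHom (congrArg T e) ≫ act m (T y)) :
    piVal μT εT hT f = m := by
  obtain ⟨e', h'⟩ := piVal_spec μT εT hT f
  exact eq_of_eqToHom_act e' e (h'.symm.trans h)

/-- The valuation on the skeletal category defined by a choice of representatives of `π₀`. -/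
noncomputable def piValuation : Valuation (TensorData.ofPi0 T μT εT).Cat (Pi1 C) where
  val f := piVal μT εT hT f
  eq_of_hom f := (piVal_spec μT εT hT f).choose
  injective {x y f g} h := (TensorData.ofPi0 T μT εT).forget.map_injective (by
    obtain ⟨e, hf⟩ := piVal_spec μT εT hT f
    obtain ⟨e', hg⟩ := piVal_spec μT εT hT g
    exact hf.trans ((congrArg (fun m => eqToHom (congrArg T e) ≫ act m (T y)) h).trans hg.symm))
  hom {x y} e m := (TensorData.ofPi0 T μT εT).homMk (eqToHom (congrArg T e) ≫ act m (T y))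
  val_hom e m := piVal_eq μT εT hT _ m e rfl
  val_id x := piVal_eq μT εT hT _ 0 rfl (by
    rw [act_zero, eqToHom_refl, Category.id_comp]
    exact (TensorData.ofPi0 T μT εT).forget.map_id x)
  val_comp f g := by
    obtain ⟨e, h⟩ := piVal_spec μT εT hT f
    obtain ⟨e', h'⟩ := piVal_spec μT εT hT g
    generalize piVal μT εT hT f = m at *
    generalize piVal μT εT hT g = n at *
    refine piVal_eq μT εT hT _ _ (e.trans e') ?_
    rw [Functor.map_comp, h, h']
    exact eqToHom_act_comp (congrArg T e) (congrArg T e') m n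
  val_whiskerLeft x {y z} f := by
    obtain ⟨e, h⟩ := piVal_spec μT εT hT f
    generalize piVal μT εT hT f = m at *
    refine piVal_eq μT εT hT _ _ (congrArg (fun y => x ⊗ y) e) ?_
    change (μT x y).inv ≫ T x ◁ (TensorData.ofPi0 T μT εT).forget.map f ≫ (μT x z).hom = _
    rw [h]
    exact eqToHom_act_whiskerLeft T (fun y => T ((show Pi0 C from x) + y)) (T x) (μT x) e m
  val_whiskerRight {y z} f x := by
    obtain ⟨e, h⟩ := piVal_spec μT εT hT f
    generalize piVal μT εT hT f = m at *
    refine piVal_eq μT εT hT _ _ (congrArg (fun y => y ⊗ x) e) ?_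
    change (μT y x).inv ≫ (TensorData.ofPi0 T μT εT).forget.map f ▷ T x ≫ (μT z x).hom = _
    rw [h]
    exact eqToHom_act_whiskerRight T (fun y => T (y + (show Pi0 C from x))) (T x)
      (fun y => μT y x) e m

/-- The objects of the skeletal category are the elements of `π₀`. -/
def toCat (x : Pi0 C) : (TensorData.ofPi0 T μT εT).Cat := x

lemma forget_map_hom {x y : (TensorData.ofPi0 T μT εT).Cat} (e : x = y) (m : Pi1 C) :
    (TensorData.ofPi0 T μT εT).forget.map ((piValuation μT εT hT).hom e m) =
      eqToHom (congrArg T e) ≫ act m (T y) := rfl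

lemma val_eq_zero {x y : (TensorData.ofPi0 T μT εT).Cat} (f : x ⟶ y)
    (h : ∃ e, (TensorData.ofPi0 T μT εT).forget.map f = eqToHom e) :
    (piValuation μT εT hT).val f = 0 := by
  obtain ⟨e', h⟩ := h
  have e := (piValuation μT εT hT).eq_of_hom f
  have : f = (piValuation μT εT hT).hom e 0 := by
    apply (TensorData.ofPi0 T μT εT).forget.map_injective
    rw [h, forget_map_hom, act_zero, Category.comp_id]
    rfl
  rw [this, Valuation.val_hom]

variable {ω : Z3ab (Pi0 C) (Pi1 C)} (e₀ : Pi1 C) (k : Pi0 C → Pi0 C → Pi1 C)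

local notation "V" => piValuation μT εT hT
local notation "o" => toCat μT εT

lemma isAbelianCocycleOf_of_valuation
    (hl : ∀ x, (V).val (λ_ (o x)).hom = e₀ + k 0 x)
    (hr : ∀ x, (V).val (ρ_ (o x)).hom = e₀ + k x 0)
    (hh : ∀ x y z, hmap ω x y z = (V).val (α_ (o x) (o y) (o z)).hom +
      (k y z - k (x + y) z + k x (y + z) - k x y))
    (hc : ∀ x y, cmap ω x y = (V).val (β_ (o x) (o y)).hom + (k y x - k x y)) :
    IsAbelianCocycleOf C ω := by
  let P := TensorData.ofPi0 T μT εT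
  let _ : ((V).functor o ω).Braided :=
    (V).functorBraided o (fun _ _ => rfl) rfl e₀ k hl hr hh hc
  have : ((V).functor o ω).IsEquivalence :=
    (V).functor_isEquivalence o ω ⟨fun _ _ h => h, fun x => ⟨x, rfl⟩⟩
  have : P.forget.EssSurj := ⟨fun X => ⟨Pi0.mk X, Pi0.mk_eq_mk_iff.1 (hT _)⟩⟩
  have : P.forget.IsEquivalence := {}
  refine ⟨(V).functor o ω ⋙ P.forget, inferInstance, inferInstance, fun X => hT _, fun m => ?_⟩
  rw [← act_unit, ← act_naturality]
  refine congrArg _ ((forget_map_hom μT εT hT rfl m).trans ?_)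
  exact Category.id_comp _

end Existence

section

variable (C : Type u) [Category.{v} C] [MonoidalCategory C] [BraidedCategory C]
  [IsBraidedCategoricalGroup C]

lemma exists_representatives : ∃ (T : Pi0 C → C) (_ : ∀ x, Pi0.mk (T x) = x)
    (_ : ∀ x y, T x ⊗ T y ≅ T (x + y)), Nonempty (𝟙_ C ≅ T 0) := by
  choose T hT using fun x : Pi0 C => Pi0.mk_surjective x
  exact ⟨T, hT, fun x y => (Pi0.mk_eq_mk_iff.1 (by rw [Pi0.mk_tensor, hT, hT, hT])).some,
    Pi0.mk_eq_mk_iff.1 (by rw [hT, Pi0.mk_unit])⟩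

/-- Every braided categorical group has an abelian 3-cocycle. -/
theorem exists_isAbelianCocycleOf : ∃ ω, IsAbelianCocycleOf C ω := by
  classical
  obtain ⟨T, hT, μT, ⟨εT⟩⟩ := exists_representatives C
  let W := piValuation μT εT hT
  let o := toCat μT εT
  let e₀ := W.val (λ_ (o 0)).hom
  -- k lives on the axes and measures how far the unitors are from the constant e₀. The two
  -- prescriptions agree at (0,0) because the left and right unitors of the unit coincide.
  let k : Pi0 C → Pi0 C → Pi1 C := fun x y => if x = 0 then W.val (λ_ (o y)).hom - e₀ else
    if y = 0 then W.val (ρ_ (o x)).hom - e₀ else 0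
  have hl : ∀ x, W.val (λ_ (o x)).hom = e₀ + k 0 x := fun x => by simp [k]
  have hr : ∀ x, W.val (ρ_ (o x)).hom = e₀ + k x 0 := fun x => by
    by_cases hx : x = 0
    · subst hx
      have : (ρ_ (o 0)).hom = (λ_ (o 0)).hom := unitors_equal.symm
      exact (congrArg W.val this).trans (hl 0)
    · simp [k, hx]
  exact ⟨⟨_, W.cocycle_mem o (fun _ _ => rfl) rfl e₀ k hl hr⟩,
    isAbelianCocycleOf_of_valuation μT εT hT e₀ k hl hr (fun _ _ _ => rfl) fun _ _ => rfl⟩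

variable {C}

/-- A braided categorical group with a faithful monoidal functor to a category in which the
images of its objects are strictly associative has an abelian 3-cocycle `(0, c)`. -/
theorem exists_isAbelianCocycleOf_strict {D : Type*} [Category* D] [MonoidalCategory D]
    (Q : C ⥤ D) [Q.Monoidal] [Q.Faithful]
    (hQ : ∀ X Y Z : C, Nonempty (X ⊗ Y ≅ Z) → ∃ (i : X ⊗ Y ≅ Z) (e : Q.obj X ⊗ Q.obj Y = Q.obj Z),
      μ Q X Y ≫ Q.map i.hom = eqToHom e)
    (hα : ∀ X Y Z : C, ∃ e, (α_ (Q.obj X) (Q.obj Y) (Q.obj Z)).hom = eqToHom e) :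
    ∃ ω, IsAbelianCocycleOf C ω ∧ ∀ x y z, hmap ω x y z = 0 := by
  obtain ⟨T, hT, μ₀, ⟨εT⟩⟩ := exists_representatives C
  -- The tensor isomorphisms are chosen so that those of the composite functor to D are equalities;
  -- this forces the transported associators to have value 0.
  choose μT e hμ using fun x y => hQ (T x) (T y) (T (x + y)) ⟨μ₀ x y⟩
  let P := TensorData.ofPi0 T μT εT
  let W := piValuation μT εT hT
  let o := toCat μT εT
  have hα0 : ∀ x y z, W.val (α_ (o x) (o y) (o z)).hom = 0 := fun x y z => by
    obtain ⟨e', h⟩ := exists_map_associator_eq_eqToHom (P.forget ⋙ Q)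
      (fun x y => ⟨e x y, hμ x y⟩) (hα (T x) (T y) (T z))
    exact val_eq_zero μT εT hT _ ⟨congrArg T (add_assoc x y z),
      Q.map_injective (h.trans (eqToHom_map Q _).symm)⟩
  let e₀ := W.val (λ_ (o 0)).hom
  -- With trivial associators the triangle equates every left unitor with every right unitor. All
  -- have value e₀, so no correction k is needed and h stays 0.
  have htri : ∀ x z, W.val (λ_ (o z)).hom = W.val (ρ_ (o x)).hom := fun x z => by
    have := congrArg W.val (triangle (o x) (o z))
    rw [W.val_comp, W.val_whiskerLeft, W.val_whiskerRight] at this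
    rw [← this]
    exact (zero_add _).symm.trans (congrArg (· + _) (hα0 x 0 z).symm)
  have hl : ∀ x, W.val (λ_ (o x)).hom = e₀ + 0 := fun x => by
    rw [add_zero, htri 0 x, ← htri 0 0]
  have hr : ∀ x, W.val (ρ_ (o x)).hom = e₀ + 0 := fun x => by rw [add_zero, ← htri x 0]
  exact ⟨⟨_, W.cocycle_mem o (fun _ _ => rfl) rfl e₀ (fun _ _ => 0) hl hr⟩,
    isAbelianCocycleOf_of_valuation μT εT hT e₀ (fun _ _ => 0) hl hr (fun _ _ _ => rfl)
      fun _ _ => rfl, fun x y z => by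
    change W.val (α_ (o x) (o y) (o z)).hom + _ = 0
    simp [hα0]⟩

end

/-! ### Uniqueness of the abelian 3-cocycle -/

section Comparison

variable {G : Type u} {M : Type v} [AddCommGroup G] [AddCommGroup M]

/-- The tautological valuation on a skeletal model. -/
def SkeletalModel.valuation (ω : Z3ab G M) : Valuation (SkeletalModel ω) M where
  val := SkeletalModel.Hom.val
  eq_of_hom := SkeletalModel.Hom.eq
  injective := SkeletalModel.hom_ext'
  hom := SkeletalModel.Hom.mk
  val_hom _ _ := rfl
  val_id _ := rfl
  val_comp _ _ := rfl
  val_whiskerLeft _ _ _ _ := rfl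
  val_whiskerRight _ _ := rfl

/-- Cohomologous abelian 3-cocycles have braided equivalent skeletal models. -/
lemma exists_comparison {ω ω' : Z3ab G M} (h : ω' - ω ∈ B3ab G M) :
    ∃ (F : SkeletalModel ω' ⥤ SkeletalModel ω) (_ : F.Braided), F.IsEquivalence ∧
      (∀ X, (F.obj X).of = X.of) ∧
      ∀ m, ε F ≫ F.map (SkeletalModel.unitHom ω' m) = SkeletalModel.unitHom ω m ≫ ε F := by
  obtain ⟨k, hk, hk', hh, hc⟩ := h
  have hh' : ∀ x y z, hmap ω' x y z =
      hmap ω x y z + (k y z - k (x + y) z + k x (y + z) - k x y) := fun x y z =>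
    eq_add_of_sub_eq' (hh x y z)
  have hc' : ∀ x y, cmap ω' x y = cmap ω x y + (k y x - k x y) := fun x y =>
    eq_add_of_sub_eq' (hc x y)
  let W := SkeletalModel.valuation ω
  let o : G → SkeletalModel ω := fun x => ⟨x⟩
  let _ : (W.functor o ω').Braided := W.functorBraided o (fun _ _ => rfl) rfl 0 k
    (fun x => (by rw [hk', add_zero]; rfl)) (fun x => (by rw [hk, add_zero]; rfl)) hh' hc'
  refine ⟨W.functor o ω', inferInstance,
    W.functor_isEquivalence o ω' ⟨fun x y h => congrArg SkeletalModel.of h, fun x => ⟨x.of, rfl⟩⟩,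
    fun _ => rfl, fun m => SkeletalModel.hom_ext' ?_⟩
  rw [SkeletalModel.val_comp, SkeletalModel.val_comp, add_comm]
  rfl

/-- Braided functors between skeletal models inducing the identity on `π₀` and `π₁` exist only
between cohomologous abelian 3-cocycles. -/
lemma sub_mem_B3ab_of_functor {ω ω' : Z3ab G M} (F : SkeletalModel ω' ⥤ SkeletalModel ω)
    [F.Braided] (hF : ∀ X, (F.obj X).of = X.of)
    (hm : ∀ m, ε F ≫ F.map (SkeletalModel.unitHom ω' m) = SkeletalModel.unitHom ω m ≫ ε F) :
    ω' - ω ∈ B3ab G M := by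
  have hval_unit : ∀ m, SkeletalModel.Hom.val (F.map (SkeletalModel.unitHom ω' m)) = m :=
    fun m => by
      have := congrArg SkeletalModel.Hom.val (hm m)
      rw [SkeletalModel.val_comp, SkeletalModel.val_comp, add_comm] at this
      exact add_right_cancel this
  -- An automorphism of X is, through the left unitor, a unit automorphism whiskered by X;
  -- naturality of μ reduces the claim to the unit.
  have hval_aut : ∀ (X : SkeletalModel ω') (f : X ⟶ X),
      SkeletalModel.Hom.val (F.map f) = SkeletalModel.Hom.val f := fun X f => by
    have h1 : SkeletalModel.unitHom ω' (SkeletalModel.Hom.val f) ▷ X ≫ (λ_ X).hom =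
        (λ_ X).hom ≫ f := SkeletalModel.hom_ext' (by
      simp only [SkeletalModel.val_comp, SkeletalModel.val_whiskerRight,
        SkeletalModel.val_leftUnitor_hom, add_zero, zero_add]
      rfl)
    have h2 := congrArg SkeletalModel.Hom.val (congrArg F.map h1)
    rw [F.map_comp, F.map_comp, SkeletalModel.val_comp, SkeletalModel.val_comp, add_comm] at h2
    have h3 := congrArg SkeletalModel.Hom.val
      (μ_natural_left F (SkeletalModel.unitHom ω' (SkeletalModel.Hom.val f)) X)
    rw [SkeletalModel.val_comp, SkeletalModel.val_comp, add_comm,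
      SkeletalModel.val_whiskerRight, hval_unit] at h3
    rw [← add_left_cancel h2, ← add_left_cancel h3]
  have hval : ∀ (X Y : SkeletalModel ω') (f : X ⟶ Y),
      SkeletalModel.Hom.val (F.map f) = SkeletalModel.Hom.val f := fun X Y f => by
    obtain rfl := SkeletalModel.Hom.eq f
    exact hval_aut X f
  let e : M := SkeletalModel.Hom.val (ε F)
  let k : G → G → M := fun x y => SkeletalModel.Hom.val (μ F ⟨x⟩ ⟨y⟩)
  have hl : ∀ x, e + k 0 x = 0 := fun x => by
    have := congrArg SkeletalModel.Hom.val (Functor.LaxMonoidal.left_unitality F ⟨x⟩)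
    rw [SkeletalModel.val_comp, SkeletalModel.val_comp, hval, SkeletalModel.val_leftUnitor_hom,
      SkeletalModel.val_leftUnitor_hom, SkeletalModel.val_whiskerRight, add_zero] at this
    exact this.symm
  have hr : ∀ x, e + k x 0 = 0 := fun x => by
    have := congrArg SkeletalModel.Hom.val (Functor.LaxMonoidal.right_unitality F ⟨x⟩)
    rw [SkeletalModel.val_comp, SkeletalModel.val_comp, hval, SkeletalModel.val_rightUnitor_hom,
      SkeletalModel.val_rightUnitor_hom, SkeletalModel.val_whiskerLeft, add_zero] at this
    exact this.symm
  -- Adding the value e of the unit constraint normalizes k by the unitality axioms, and the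
  -- constant cancels from the coboundary.
  refine ⟨fun x y => e + k x y, hr, hl, fun x y z => ?_, fun x y => ?_⟩
  · have := congrArg SkeletalModel.Hom.val (Functor.LaxMonoidal.associativity F ⟨x⟩ ⟨y⟩ ⟨z⟩)
    simp only [SkeletalModel.val_comp, hval, SkeletalModel.val_whiskerLeft,
      SkeletalModel.val_whiskerRight, SkeletalModel.val_associator_hom, hF] at this
    change k x y + (k (x + y) z + _) = _ + (k y z + k x (y + z)) at this
    change hmap ω' x y z - hmap ω x y z = _
    beta_reduce
    linear_combination (norm := abel) this
  · have := congrArg SkeletalModel.Hom.val (Functor.LaxBraided.braided (F := F) ⟨x⟩ ⟨y⟩)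
    rw [SkeletalModel.val_comp, SkeletalModel.val_comp, hval] at this
    have h1 : SkeletalModel.Hom.val (β_ (F.obj ⟨x⟩) (F.obj ⟨y⟩)).hom = cmap ω x y := by
      change cmap ω (F.obj ⟨x⟩).of (F.obj ⟨y⟩).of = _
      rw [hF, hF]
    rw [h1] at this
    change k x y + cmap ω' x y = cmap ω x y + k y x at this
    change cmap ω' x y - cmap ω x y = _
    beta_reduce
    linear_combination (norm := abel) this

end Comparison

/-! ### The cohomology class and the cohomological equivalences -/

section

variable {C : Type u} [Category.{v} C] [MonoidalCategory C] [BraidedCategory C]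
  [IsBraidedCategoricalGroup C]

lemma IsAbelianCocycleOf.of_sub_mem {ω ω' : Z3ab (Pi0 C) (Pi1 C)} (h : IsAbelianCocycleOf C ω)
    (hω : ω' - ω ∈ B3ab _ _) : IsAbelianCocycleOf C ω' := by
  obtain ⟨F, _, _, h0, h1⟩ := h
  obtain ⟨K, _, _, hK, hK'⟩ := exists_comparison hω
  refine ⟨K ⋙ F, inferInstance, inferInstance, fun X => (h0 _).trans (hK X), fun m => ?_⟩
  rw [Functor.LaxMonoidal.comp_ε, Category.assoc, Functor.comp_map, ← F.map_comp, hK', F.map_comp,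
    reassoc_of% (h1 m)]

/-- One equivalence followed by a braided inverse of the other compares the two models and is the
identity on π₀ and π₁, so `sub_mem_B3ab_of_functor` applies. -/
lemma IsAbelianCocycleOf.sub_mem {ω ω' : Z3ab (Pi0 C) (Pi1 C)} (h : IsAbelianCocycleOf C ω)
    (h' : IsAbelianCocycleOf C ω') : ω' - ω ∈ B3ab _ _ := by
  obtain ⟨F, _, _, h0, h1⟩ := h
  obtain ⟨F', _, _, h0', h1'⟩ := h'
  obtain ⟨e, _, he, hinv⟩ := exists_braided_inverse F
  refine sub_mem_B3ab_of_functor (F' ⋙ e.inverse) (fun X => ?_) fun m => ?_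
  · obtain ⟨⟨i⟩, -⟩ := hinv (F'.obj X)
    have := Pi0.mk_eq_mk_iff.2 ⟨i⟩
    rw [h0, h0'] at this
    exact this
  · have := (hinv (𝟙_ C)).2 _ _ (h1 m)
    rw [Functor.LaxMonoidal.comp_ε, Category.assoc, Functor.comp_map, ← e.inverse.map_comp, h1',
      e.inverse.map_comp, reassoc_of% this]

/-- The abelian 3-cocycles of a braided categorical group form a cohomology class. -/
theorem exists_class : ∃ ξ : H3ab (Pi0 C) (Pi1 C),
    ∀ ω, IsAbelianCocycleOf C ω ↔ (QuotientAddGroup.mk ω : H3ab _ _) = ξ := by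
  obtain ⟨ω₀, h₀⟩ := exists_isAbelianCocycleOf C
  refine ⟨QuotientAddGroup.mk ω₀, fun ω => ⟨fun h => ?_, fun h => ?_⟩⟩
  · exact (QuotientAddGroup.eq_iff_sub_mem).2 (h₀.sub_mem h)
  · exact h₀.of_sub_mem (QuotientAddGroup.eq_iff_sub_mem.1 h)

/-- The purely cohomological equivalences, for the class `ξ` of a braided categorical group. -/
theorem tfae_of_strict_iff {p : Prop} {ξ : H3ab (Pi0 C) (Pi1 C)}
    (hξ : ∀ ω, IsAbelianCocycleOf C ω ↔ (QuotientAddGroup.mk ω : H3ab _ _) = ξ)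
    (hp : p ↔ ∃ ω, IsAbelianCocycleOf C ω ∧ ∀ x y z, hmap ω x y z = 0) :
    List.TFAE [p,
      ∃ ω : Z3ab (Pi0 C) (Pi1 C), (QuotientAddGroup.mk ω : H3ab _ _) = ξ ∧
        IsBilinear (cmap ω) ∧ ∀ x y z, hmap ω x y z = 0,
      ∃ ω : Z3ab (Pi0 C) (Pi1 C), (QuotientAddGroup.mk ω : H3ab _ _) = ξ ∧
        IsTrilinear (hmap ω) ∧ IsBilinear (cmap ω),
      ∃ S : Pi0 C → Pi0 C → Pi1 C, IsBilinear S ∧ ∀ x, (trace ξ).1 x = S x x] := by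
  tfae_have 1 → 2 := fun h => by
    obtain ⟨ω, h1, h2⟩ := hp.1 h
    have hb := fun x y z => isBilinear_of_h_eq_zero ω ⊤ (fun x _ y _ z _ => h2 x y z)
      (x := x) (y := y) (z := z) trivial trivial trivial
    exact ⟨ω, (hξ ω).1 h1, ⟨fun x y z => (hb x y z).1, fun x y z => (hb x y z).2⟩, h2⟩
  tfae_have 2 → 1 := fun ⟨ω, h1, _, h2⟩ => hp.2 ⟨ω, (hξ ω).2 h1, h2⟩
  tfae_have 2 → 3 := fun ⟨ω, h1, h2, h3⟩ => ⟨ω, h1, by simp [IsTrilinear, h3], h2⟩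
  tfae_have 3 → 4 := fun ⟨ω, h1, _, h2⟩ => ⟨cmap ω, h2, fun x => by rw [← h1]; rfl⟩
  tfae_have 4 → 2 := fun ⟨S, hS, h⟩ => ⟨hS.cocycle, trace_injective (Subtype.ext (funext fun x =>
    (h x).symm)), hS, fun _ _ _ => rfl⟩
  tfae_finish

end

lemma SkeletalModel.skeletal {G : Type u} {M : Type v} [AddCommGroup G] [AddCommGroup M]
    (ω : Z3ab G M) : Skeletal (SkeletalModel ω) :=
  fun _ _ ⟨i⟩ => SkeletalModel.Hom.eq i.hom

lemma SkeletalModel.associator_eq_eqToHom {G : Type u} {M : Type v} [AddCommGroup G]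
    [AddCommGroup M] {ω : Z3ab G M} (h : ∀ x y z, hmap ω x y z = 0) (X Y Z : SkeletalModel ω) :
    ∃ e, (α_ X Y Z).hom = eqToHom e := by
  have key : ∀ {A B : SkeletalModel ω} (e : A = B), SkeletalModel.Hom.val (eqToHom e) = 0 := by
    rintro A _ rfl
    rfl
  refine ⟨SkeletalModel.ext (add_assoc _ _ _), SkeletalModel.hom_ext' ?_⟩
  rw [SkeletalModel.val_associator_hom, h, key]

/-! ### Strictification of braided categorical groups -/

section Strictify

/-- In a skeletal target the isomorphism gives an equality of objects; fullness lifts this equality,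
composed with the inverse tensor constraint, to a better isomorphism. -/
lemma exists_iso_μ_comp_map_eq_eqToHom {C D : Type*} [Category* C] [MonoidalCategory C]
    [Category* D] [MonoidalCategory D] (F : C ⥤ D) [F.Monoidal] [F.Full] [F.Faithful]
    (hD : Skeletal D) {X Y Z : C} (i : X ⊗ Y ≅ Z) :
    ∃ (i : X ⊗ Y ≅ Z) (e : F.obj X ⊗ F.obj Y = F.obj Z), μ F X Y ≫ F.map i.hom = eqToHom e :=
  have e : F.obj X ⊗ F.obj Y = F.obj Z :=
    hD ⟨Functor.Monoidal.μIso F X Y ≪≫ F.mapIso i⟩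
  ⟨F.preimageIso ((Functor.Monoidal.μIso F X Y).symm ≪≫ eqToIso e), e, by simp⟩

variable (C : Type u) [Category.{v} C] [MonoidalCategory C] [BraidedCategory C]
  [IsBraidedCategoricalGroup C]

/-- A braided categorical group is equivalent to a skeletal and strictly associative one if and
only if it has an abelian 3-cocycle `(0, c)`. -/
theorem equivSkeletalStrict_iff :
    EquivSkeletalStrict C ↔ ∃ ω, IsAbelianCocycleOf C ω ∧ ∀ x y z, hmap ω x y z = 0 := by
  constructor
  · rintro ⟨D, _, _, _, F, _, _, hD, hα⟩
    exact exists_isAbelianCocycleOf_strict F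
      (fun X Y Z ⟨i⟩ => exists_iso_μ_comp_map_eq_eqToHom F hD i) fun X Y Z => hα _ _ _
  · rintro ⟨ω, ⟨F, _, _, -⟩, h⟩
    obtain ⟨e, _, -⟩ := exists_braided_inverse F
    exact ⟨SkeletalModel ω, inferInstance, inferInstance, inferInstance, e.inverse, inferInstance,
      inferInstance, SkeletalModel.skeletal ω, SkeletalModel.associator_eq_eqToHom h⟩

end Strictify

/-! ### The inclusion of the groupoid of simple objects -/

section Core

variable {C : Type u} [Category.{v} C] [MonoidalCategory C]

instance : (Core.inclusion C).Monoidal :=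
  Functor.CoreMonoidal.toMonoidal
    { εIso := Iso.refl (𝟙_ C)
      μIso X Y := Iso.refl (X.of ⊗ Y.of)
      μIso_hom_natural_left _ _ := (Category.comp_id _).trans (Category.id_comp _).symm
      μIso_hom_natural_right _ _ := (Category.comp_id _).trans (Category.id_comp _).symm
      associativity X Y Z := by
        change 𝟙 (X.of ⊗ Y.of) ▷ Z.of ≫ 𝟙 _ ≫ (α_ X.of Y.of Z.of).hom =
          (α_ X.of Y.of Z.of).hom ≫ X.of ◁ 𝟙 (Y.of ⊗ Z.of) ≫ 𝟙 _
        simp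
      left_unitality X := by
        change (λ_ X.of).hom = 𝟙 (𝟙_ C) ▷ X.of ≫ 𝟙 _ ≫ (λ_ X.of).hom
        simp
      right_unitality X := by
        change (ρ_ X.of).hom = X.of ◁ 𝟙 (𝟙_ C) ≫ 𝟙 _ ≫ (ρ_ X.of).hom
        simp }

end Core

section Simple

variable (C : Type u) [Category.{v} C] [Limits.HasZeroMorphisms C] [MonoidalCategory C]
  [Simple (𝟙_ C)] [IsPointed C]

/-- The inclusion of the groupoid of simple objects. -/
abbrev simpInclusion : CSimp C ⥤ C := Core.inclusion _ ⋙ (IsSimple C).ι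

lemma simpInclusion_μ (X Y : CSimp C) :
    μ (simpInclusion C) X Y = 𝟙 (X.of.obj ⊗ Y.of.obj) := by
  change 𝟙 (X.of.obj ⊗ Y.of.obj) ≫ 𝟙 _ = _
  simp

end Simple

/-! ### Skeleta with prescribed representatives -/

section Extension

variable {C : Type u} [Category.{v} C]

/-- An isomorphism class of objects not meeting the family `r`. -/
abbrev OutsideFamily {G : Type u} (r : G → C) : Type u :=
  {s : Skeleton C // ∀ x, IsEmpty (r x ≅ (fromSkeleton C).obj s)}

/-- The family `r` together with representatives of the isomorphism classes that it misses. -/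
noncomputable def extendFamily {G : Type u} (r : G → C) : G ⊕ OutsideFamily r → C :=
  Sum.elim r fun s => (fromSkeleton C).obj s.1

variable {G : Type u} (r : G → C)

lemma extendFamily_surjective (X : C) : ∃ i, Nonempty (extendFamily r i ≅ X) := by
  have e := fromSkeletonToSkeletonIso X
  by_cases h : ∃ x, Nonempty (r x ≅ X)
  · obtain ⟨x, hx⟩ := h
    exact ⟨.inl x, hx⟩
  · exact ⟨.inr ⟨toSkeleton X, fun x => ⟨fun i => h ⟨x, ⟨i ≪≫ e⟩⟩⟩⟩, ⟨e⟩⟩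

lemma extendFamily_injective (hr : ∀ x y, Nonempty (r x ≅ r y) → x = y) :
    ∀ i j, Nonempty (extendFamily r i ≅ extendFamily r j) → i = j
  | .inl x, .inl y, h => congrArg _ (hr x y h)
  | .inl x, .inr s, ⟨h⟩ => ((s.2 x).false h).elim
  | .inr s, .inl x, ⟨h⟩ => ((s.2 x).false h.symm).elim
  | .inr _, .inr _, ⟨h⟩ => congrArg _ (Subtype.ext (skeleton_skeletal C
      ⟨(fromSkeleton C).preimageIso h⟩))

variable [MonoidalCategory C] [AddCommGroup G]
  (μr : ∀ x y, r x ⊗ r y ≅ r (x + y)) (εr : 𝟙_ C ≅ r 0)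

/-- Tensor products for an extended family. -/
noncomputable def extendFamilyTensor : ∀ i j,
    Σ' l, extendFamily r i ⊗ extendFamily r j ≅ extendFamily r l
  | .inl x, .inl y => ⟨.inl (x + y), μr x y⟩
  | .inr _, _ => ⟨_, (extendFamily_surjective r _).choose_spec.some.symm⟩
  | .inl _, .inr _ => ⟨_, (extendFamily_surjective r _).choose_spec.some.symm⟩

/-- A family closed under tensor products, extended to all isomorphism classes. -/
noncomputable def TensorData.extend : TensorData C (G ⊕ OutsideFamily r) where
  obj := extendFamily r
  op i j := (extendFamilyTensor r μr i j).1
  unit := .inl 0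
  tensorIso i j := (extendFamilyTensor r μr i j).2
  unitIso := εr

end Extension

section Linear

variable {C : Type u} [Category.{v} C] [MonoidalCategory C] {ι : Type w} (P : TensorData C ι)
  [Preadditive C]

instance : Preadditive P.Cat := inferInstanceAs (Preadditive (InducedCategory C P.obj))

instance : P.forget.Additive := inferInstanceAs (inducedFunctor P.obj).Additive

variable (k : Type*) [Semiring k] [Linear k C]

instance : Linear k P.Cat := inferInstanceAs (Linear k (InducedCategory C P.obj))

instance : P.forget.Linear k := inferInstanceAs ((inducedFunctor P.obj).Linear k)

end Linear

section Extension

variable {C : Type u} [Category.{v} C] [MonoidalCategory C] {G : Type u} {M : Type w}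
  [AddCommGroup G] [AddCommGroup M] {ω : Z3ab G M} (K : SkeletalModel ω ⥤ C) [K.Monoidal]

/-- The image of a monoidal functor on a skeletal model, extended to all isomorphism classes. -/
noncomputable def TensorData.extendFunctor :
    TensorData C (G ⊕ OutsideFamily fun x => K.obj ⟨x⟩) :=
  .extend (fun x => K.obj ⟨x⟩) (fun _ _ => Functor.Monoidal.μIso K _ _) (Functor.Monoidal.εIso K)

/-- Between members of the family the tensor isomorphisms are the constraints of K, so the
associator is the K-image of the one in the model. -/
lemma TensorData.extendFunctor_associator (h : ∀ x y z, hmap ω x y z = 0) (x y z : G) :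
    let o : G → (extendFunctor K).Cat := Sum.inl
    ∃ e, (α_ (o x) (o y) (o z)).hom = eqToHom e := by
  intro o
  have h1 : (extendFunctor K).forget.map (α_ (o x) (o y) (o z)).hom =
      K.map (α_ (⟨x⟩ : SkeletalModel ω) ⟨y⟩ ⟨z⟩).hom := by
    rw [Functor.Monoidal.map_associator, Functor.Monoidal.map_associator]
    rfl
  obtain ⟨e, h2⟩ := SkeletalModel.associator_eq_eqToHom h ⟨x⟩ ⟨y⟩ ⟨z⟩
  have e' : (o x ⊗ o y) ⊗ o z = o x ⊗ (o y ⊗ o z) := congrArg o (add_assoc x y z)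
  refine ⟨e', (extendFunctor K).forget.map_injective ?_⟩
  rw [h1, h2, eqToHom_map, eqToHom_map]
  rfl

lemma TensorData.extendFunctor_skeletal
    (hK : ∀ X Y : SkeletalModel ω, Nonempty (K.obj X ≅ K.obj Y) → X = Y) :
    Skeletal (extendFunctor K).Cat := fun i j ⟨f⟩ =>
  extendFamily_injective _ (fun x y hxy => congrArg SkeletalModel.of (hK ⟨x⟩ ⟨y⟩ hxy)) i j
    ⟨(extendFunctor K).forget.mapIso f⟩

instance : (TensorData.extendFunctor K).forget.EssSurj where
  mem_essImage X := extendFamily_surjective _ X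

instance : (TensorData.extendFunctor K).forget.IsEquivalence where

lemma TensorData.extendFunctor_eq_inl
    (hK : ∀ X Y : SkeletalModel ω, Nonempty (K.obj X ≅ K.obj Y) → X = Y)
    (i : (extendFunctor K).Cat) (x : G)
    (h : Nonempty (K.obj ⟨x⟩ ≅ (extendFunctor K).forget.obj i)) : i = Sum.inl x :=
  (extendFamily_injective _ (fun x y hxy => congrArg SkeletalModel.of (hK ⟨x⟩ ⟨y⟩ hxy))
    (.inl x) i h).symm

end Extension

/-! ### Pointed braided fusion categories -/

section Fusion

variable (k : Type w) [Field k] (C : Type u) [Category.{v} C] [Preadditive C] [Linear k C]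
  [MonoidalCategory C] [BraidedCategory C] [Simple (𝟙_ C)] [IsPointed C]

/-- A pointed braided fusion category is equivalent to one that is skeletal, and strictly
associative on simple objects, if and only if its groupoid of simple objects has an abelian
3-cocycle `(0, c)`. -/
theorem linearEquivSkeletalStrict_iff :
    LinearEquivSkeletalStrict k C ↔
      ∃ ω, IsAbelianCocycleOf (CSimp C) ω ∧ ∀ x y z, hmap ω x y z = 0 := by
  constructor
  · rintro ⟨D, _, _, _, _, _, F, _, _, _, _, hD, hα⟩
    refine exists_isAbelianCocycleOf_strict (simpInclusion C ⋙ F) (fun X Y Z ⟨i⟩ => ?_)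
      fun X Y Z => ?_
    · obtain ⟨j, e, h⟩ := exists_iso_μ_comp_map_eq_eqToHom F hD ((simpInclusion C).mapIso i)
      refine ⟨Core.isoMk ((IsSimple C).isoMk j), e, ?_⟩
      rw [Functor.LaxMonoidal.comp_μ, simpInclusion_μ]
      erw [F.map_id, Category.comp_id]
      exact h
    · have hs : ∀ X : CSimp C, Simple (F.obj X.of.obj) := fun X => by
        have : Simple X.of.obj := X.of.property
        exact simple_obj F _
      exact hα _ _ _ (hs X) (hs Y) (hs Z)
  · rintro ⟨ω, ⟨F, _, _, hF, -⟩, h⟩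
    let K := F ⋙ simpInclusion C
    let P := TensorData.extendFunctor K
    have hK : ∀ X Y : SkeletalModel ω, Nonempty (K.obj X ≅ K.obj Y) → X = Y := fun X Y ⟨i⟩ => by
      have := Pi0.mk_eq_mk_iff.2 ⟨(Core.isoMk ((IsSimple C).isoMk i) : F.obj X ≅ F.obj Y)⟩
      rw [hF, hF] at this
      exact SkeletalModel.ext this
    obtain ⟨e, _, he, -⟩ := exists_braided_inverse P.forget
    have : e.functor.Additive := he ▸ inferInstance
    have : e.functor.Linear k := he ▸ inferInstance
    -- F is essentially surjective onto the simple objects, so each simple class is represented by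
    -- the model, and strictness is only needed there.
    have hs : ∀ i : P.Cat, Simple i → ∃ x, i = Sum.inl x := fun i _ => by
      have hi : Simple (P.forget.obj i) := simple_obj P.forget i
      let Y : CSimp C := ⟨⟨P.forget.obj i, hi⟩⟩
      exact ⟨_, TensorData.extendFunctor_eq_inl K hK i (F.objPreimage Y).of
        ⟨(simpInclusion C).mapIso (F.objObjPreimageIso Y)⟩⟩
    refine ⟨P.Cat, inferInstance, inferInstance, inferInstance, inferInstance, inferInstance,
      e.inverse, inferInstance, inferInstance, inferInstance, inferInstance,
      TensorData.extendFunctor_skeletal K hK, fun X Y Z hX hY hZ => ?_⟩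
    obtain ⟨x, rfl⟩ := hs X hX
    obtain ⟨y, rfl⟩ := hs Y hY
    obtain ⟨z, rfl⟩ := hs Z hZ
    exact TensorData.extendFunctor_associator K h x y z

end Fusion

end BraidedSkeletal

theorem mainTheorem7 :
    (∀ (k : Type w) [Field k] [IsAlgClosed k] (C : Type u) [Category.{v} C] [Abelian C]
      [Linear k C] [MonoidalCategory C] [MonoidalPreadditive C] [MonoidalLinear k C]
      [RigidCategory C] [BraidedCategory C] [IsFinSemisimple k C] [Simple (𝟙_ C)] [IsPointed C],
      ∃ ξ : H3ab (Pi0 (CSimp C)) (Pi1 (CSimp C)),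
        (∀ ω, IsAbelianCocycleOf (CSimp C) ω ↔ (QuotientAddGroup.mk ω : H3ab _ _) = ξ) ∧
        List.TFAE [
          LinearEquivSkeletalStrict k C,
          ∃ ω : Z3ab (Pi0 (CSimp C)) (Pi1 (CSimp C)), (QuotientAddGroup.mk ω : H3ab _ _) = ξ ∧
            IsBilinear (cmap ω) ∧ ∀ x y z, hmap ω x y z = 0,
          ∃ ω : Z3ab (Pi0 (CSimp C)) (Pi1 (CSimp C)), (QuotientAddGroup.mk ω : H3ab _ _) = ξ ∧
            IsTrilinear (hmap ω) ∧ IsBilinear (cmap ω),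
          ∃ S : Pi0 (CSimp C) → Pi0 (CSimp C) → Pi1 (CSimp C), IsBilinear S ∧
            ∀ x, (trace ξ).1 x = S x x]) ∧
    (∀ (C : Type u) [Category.{v} C] [MonoidalCategory C] [BraidedCategory C]
      [IsBraidedCategoricalGroup C],
      ∃ ξ : H3ab (Pi0 C) (Pi1 C),
        (∀ ω, IsAbelianCocycleOf C ω ↔ (QuotientAddGroup.mk ω : H3ab _ _) = ξ) ∧
        List.TFAE [
          EquivSkeletalStrict C,
          ∃ ω : Z3ab (Pi0 C) (Pi1 C), (QuotientAddGroup.mk ω : H3ab _ _) = ξ ∧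
            IsBilinear (cmap ω) ∧ ∀ x y z, hmap ω x y z = 0,
          ∃ ω : Z3ab (Pi0 C) (Pi1 C), (QuotientAddGroup.mk ω : H3ab _ _) = ξ ∧
            IsTrilinear (hmap ω) ∧ IsBilinear (cmap ω),
          ∃ S : Pi0 C → Pi0 C → Pi1 C, IsBilinear S ∧ ∀ x, (trace ξ).1 x = S x x]) := by
  constructor
  · intro k _ _ C _ _ _ _ _ _ _ _ _ _ _
    obtain ⟨ξ, hξ⟩ := exists_class (C := CSimp C)
    exact ⟨ξ, hξ, tfae_of_strict_iff hξ (linearEquivSkeletalStrict_iff k C)⟩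
  · intro C _ _ _ _
    obtain ⟨ξ, hξ⟩ := exists_class (C := C)
    exact ⟨ξ, hξ, tfae_of_strict_iff hξ (equivSkeletalStrict_iff C)⟩
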